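/- Let $K\subset\mathbb C$ be a compact set such that $\mathbb C\setminus K$ is connected. Let $v:\mathbb C\to[-\infty,+\infty)$ be a subharmonic function, not identically $-\infty$, whose distributional Laplacian $\Delta v$ (a positive Borel measure, finite on compact sets, with $\int\varphi\,d(\Delta v)=\int v\,\Delta\varphi\,dA$ for all $\varphi\in C_c^\infty(\mathbb C)$, where $A$ is Lebesgue measure) satisfies the following two conditions: the support of $\Delta v$ is contained in $\partial K$, and $\Delta v(\partial U)=0$ for every connected component $U$ of the interior of $K$. Then any subharmonic function $u:\mathbb C\to[-\infty,+\infty)$ with $u(z)=v(z)$ for all $z\in\mathbb C\setminus K$ satisfies $u(z)=v(z)$ for all $z\in\mathbb C$. (A function $\mathbb C\to[-\infty,+\infty)$ is subharmonic if it is upper semicontinuous and satisfies the local submean inequality on small circles around every point.) -/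

import Mathlib

open MeasureTheory

noncomputable section

/-- The integral `∫ f dμ = ∫ f⁺ dμ - ∫ f⁻ dμ ∈ [-∞, +∞]` of an extended-real-valued function.
It is only used for functions that are bounded above on a space of finite measure, so that
`∫ f⁺ dμ < ∞`. -/
def erealIntegral {α : Type*} [MeasurableSpace α] (μ : Measure α) (f : α → EReal) : EReal :=
  ((∫⁻ x, (f x).toENNReal ∂μ : ENNReal) : EReal) - ((∫⁻ x, (-f x).toENNReal ∂μ : ENNReal) : EReal)

/-- The mean `(1 / 2π) ∫₀^{2π} u(z + r e^{it}) dt ∈ [-∞, +∞]` of `u` over the circle of centre `z`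
and radius `r`. -/
def circleMean (u : ℂ → EReal) (z : ℂ) (r : ℝ) : EReal :=
  (((2 * Real.pi)⁻¹ : ℝ) : EReal) *
    erealIntegral (volume.restrict (Set.Ioc 0 (2 * Real.pi))) (fun t => u (circleMap z r t))

/-- A function `u : ℂ → [-∞, +∞)` is subharmonic on `ℂ` if it is upper semicontinuous and satisfies
the local submean inequality: every `z` has a `ρ > 0` such that
`u(z) ≤ (1 / 2π) ∫₀^{2π} u(z + r e^{it}) dt` for `0 < r < ρ`.
The constant function `-∞` is allowed. -/
structure IsSubharmonic (u : ℂ → EReal) : Prop where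
  lt_top : ∀ z, u z < ⊤
  upperSemicontinuous : UpperSemicontinuous u
  submean : ∀ z, ∃ ρ : ℝ, 0 < ρ ∧ ∀ r : ℝ, 0 < r → r < ρ → u z ≤ circleMean u z r

/-- The Borel measure `μ`, finite on compact sets, is the Laplacian of `v` in the sense of
distributions: `∫ φ dμ = ∫ v Δφ dA` for all smooth compactly supported `φ : ℂ → ℝ`, where `A` is
Lebesgue measure. It is used for `v` subharmonic and not identically `-∞`; then `v` is finite almost
everywhere and locally integrable, so that `toReal` changes `v` only on a null set. -/
structure IsLaplacian (v : ℂ → EReal) (μ : Measure ℂ) : Prop where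
  finite_of_isCompact : ∀ C : Set ℂ, IsCompact C → μ C < ⊤
  integral_eq : ∀ φ : ℂ → ℝ, ContDiff ℝ (⊤ : ℕ∞) φ → HasCompactSupport φ →
    ∫ z, φ z ∂μ = ∫ z, (v z).toReal * Laplacian.laplacian φ z

open Classical in
/-- The positive measure `Δv`: the unique measure that is the distributional Laplacian of `v`. It
exists for every subharmonic `v` that is not identically `-∞` (the value is `0` for a function `v`
whose distributional Laplacian is not a positive measure). -/
def laplacianMeasure (v : ℂ → EReal) : Measure ℂ :=
  if h : ∃ μ : Measure ℂ, IsLaplacian v μ then h.choose else 0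

end

open MeasureTheory Set Filter Topology Metric CompactlySupported

/-! Agreement on ∂K comes from the topology of K; agreement inside K comes from the two conditions
on Δv.

Boundary. The complement of K is connected and unbounded and accumulates at each z₀ ∈ ∂K, so it
meets every circle about z₀ (`IsCompact.exists_mem_compl_sphere`). Such a set is not thin at z₀: if
on every small circle about z₀ a subharmonic function takes some value at most c, then its value at
z₀ is at most c (`IsSubharmonic.le_of_forall_sphere`). For c > v(z₀), upper semicontinuity gives v <
c near z₀, and u = v off K, so u(z₀) ≤ c. Hence u ≤ v on ∂K, and the reverse inequality follows by
symmetry. Non-thinness is proved with potentials. Up to a positive factor and a continuous term, -u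
is a potential of Δu with a truncated logarithmic kernel. Since |w - z| ≥ ||w - z₀| - |z - z₀||,
projecting the mass circularly onto the ray from z₀ through z can only raise the potential at z. The
projected potential depends only on |z - z₀|, and because the logarithm is integrable, its averages
over short ranges of radii are asymptotically no larger than the potential at z₀.

Interior. Suppose u and v are comparable and agree off the interior of K. Let U be a component of
that interior, and replace u by v off U. The glued function is still subharmonic
(`IsSubharmonic.piecewise`), and Δv does not charge the closure of U. Testing with cutoffs equal to
1 near this closure shows that both Laplacians have the same small mass there, so the difference of
the two functions has zero distributional Laplacian (`IsSubharmonic.eq_of_measure_closure_eq_zero`).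
It has compact support, so its Fourier transform vanishes and it is zero almost everywhere;
subharmonic functions equal almost everywhere are equal everywhere. Comparability is obtained by
treating max(u, v) first, which gives u ≤ v, and then u itself.

The potential theory rests on two facts derived from the local definition: the submean inequality on
all circles, and the existence of the Laplacian as a positive measure. -/

/-! ### From the local submean inequality to all circles -/

theorem erealIntegral_mono {α : Type*} [MeasurableSpace α] {μ : Measure α} {f g : α → EReal}
    (h : ∀ x, f x ≤ g x) : erealIntegral μ f ≤ erealIntegral μ g := by
  refine EReal.sub_le_sub ?_ ?_
  · exact EReal.coe_ennreal_le_coe_ennreal_iff.2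
      (lintegral_mono fun x => EReal.toENNReal_le_toENNReal (h x))
  · exact EReal.coe_ennreal_le_coe_ennreal_iff.2
      (lintegral_mono fun x => EReal.toENNReal_le_toENNReal (EReal.neg_le_neg_iff.2 (h x)))

theorem erealIntegral_coe {α : Type*} [MeasurableSpace α] {μ : Measure α} {f : α → ℝ}
    (hf : Integrable f μ) : erealIntegral μ (fun x => (f x : EReal)) = ((∫ x, f x ∂μ : ℝ) : EReal) := by
  have h1 : (∫⁻ x, ENNReal.ofReal (f x) ∂μ) ≠ ⊤ := hf.lintegral_lt_top.ne
  have h2 : (∫⁻ x, ENNReal.ofReal (-f x) ∂μ) ≠ ⊤ := hf.neg.lintegral_lt_top.ne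
  rw [integral_eq_lintegral_pos_part_sub_lintegral_neg_part hf, erealIntegral, EReal.coe_sub]
  simp only [← EReal.coe_neg, EReal.toENNReal_of_ne_top (EReal.coe_ne_top _), EReal.toReal_coe]
  rw [EReal.coe_ennreal_toReal h1, EReal.coe_ennreal_toReal h2]

theorem circleMean_le_re {u : ℂ → EReal} {G : ℂ → ℂ} (hG : Differentiable ℂ G) {z : ℂ} {s : ℝ}
    (hs : 0 < s) (h : ∀ w ∈ sphere z s, u w ≤ ((G w).re : EReal)) :
    circleMean u z s ≤ ((G z).re : EReal) := by
  have hc : Continuous fun t : ℝ => (G (circleMap z s t)).re :=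
    Complex.continuous_re.comp (hG.continuous.comp (continuous_circleMap z s))
  have key : circleMean u z s ≤ (((2 * Real.pi)⁻¹ : ℝ) : EReal) *
      erealIntegral (volume.restrict (Set.Ioc 0 (2 * Real.pi)))
        (fun t => ((G (circleMap z s t)).re : EReal)) := by
    refine mul_le_mul_of_nonneg_left (erealIntegral_mono fun t => h _ ?_) ?_
    · exact circleMap_mem_sphere z hs.le t
    · exact_mod_cast (by positivity : (0 : ℝ) ≤ (2 * Real.pi)⁻¹)
  refine key.trans (le_of_eq ?_)
  rw [erealIntegral_coe (hc.integrableOn_Ioc), ← EReal.coe_mul]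
  congr 1
  have h1 : Real.circleAverage (Complex.reCLM ∘ G) z s = (G z).re := by
    rw [Complex.reCLM.circleAverage_comp_comm, hG.diffContOnCl.circleAverage]
    · rfl
    · exact hG.continuous.continuousOn.circleIntegrable'
  rw [← h1, Real.circleAverage_def, intervalIntegral.integral_of_le (by positivity), smul_eq_mul]
  rfl

/-- Maximum principle against harmonic functions. Comparing only with real parts of entire functions
means that the local submean inequality is used through monotonicity of the mean alone. -/
theorem IsSubharmonic.le_re_of_lt_on_sphere {u : ℂ → EReal} (hu : IsSubharmonic u) {H : ℂ → ℂ}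
    (hH : Differentiable ℂ H) {z₀ : ℂ} {r : ℝ} (hr : 0 < r)
    (h : ∀ w ∈ sphere z₀ r, u w < ((H w).re : EReal)) : u z₀ ≤ ((H z₀).re : EReal) := by
  -- The term δ(r² - |w - z₀|²) vanishes on the circle and makes the comparison function strictly
  -- superharmonic, so a positive interior maximum of u - q is impossible.
  have key : ∀ δ : ℝ, 0 < δ → u z₀ ≤ (((H z₀).re + δ * r ^ 2 : ℝ) : EReal) := by
    intro δ hδ
    set q : ℂ → ℝ := fun w => (H w).re + δ * (r ^ 2 - ‖w - z₀‖ ^ 2) with hq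
    have hqc : Continuous q := by
      have := hH.continuous
      fun_prop
    have husc : UpperSemicontinuous (fun w => u w + ((-q w : ℝ) : EReal)) := by
      refine UpperSemicontinuous.add' hu.upperSemicontinuous
        (Continuous.upperSemicontinuous (continuous_coe_real_ereal.comp hqc.neg)) fun x => ?_
      exact EReal.continuousAt_add (Or.inr (EReal.coe_ne_bot _)) (Or.inr (EReal.coe_ne_top _))
    obtain ⟨z₁, hz₁, hmax⟩ := UpperSemicontinuousOn.exists_isMaxOn
      (s := closedBall z₀ r) ⟨z₀, mem_closedBall_self hr.le⟩ (isCompact_closedBall z₀ r)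
      (husc.upperSemicontinuousOn _)
    by_cases hpos : u z₁ + ((-q z₁ : ℝ) : EReal) ≤ 0
    · have h0 := (hmax (mem_closedBall_self hr.le)).trans hpos
      have hne := (hu.lt_top z₀).ne
      induction h1 : u z₀ with
      | bot => exact bot_le
      | top => exact absurd h1 hne
      | coe a =>
        simp only [h1] at h0
        have : a + -q z₀ ≤ 0 := by exact_mod_cast h0
        simp only [hq, sub_self, norm_zero] at this
        exact_mod_cast (by nlinarith : a ≤ (H z₀).re + δ * r ^ 2)
    · exfalso
      have hne := (hu.lt_top z₁).ne
      induction h1 : u z₁ with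
      | bot => simp [h1] at hpos
      | top => exact absurd h1 hne
      | coe a =>
        rw [h1] at hpos
        have hpos' : 0 < a + -q z₁ := by
          by_contra hcon
          exact hpos (by exact_mod_cast not_lt.1 hcon)
        have hz₁b : z₁ ∈ ball z₀ r := by
          rcases (mem_closedBall.1 hz₁).lt_or_eq with h2 | h2
          · exact h2
          · exfalso
            have h3 := h z₁ h2
            rw [h1] at h3
            have h3' : a < (H z₁).re := by exact_mod_cast h3
            rw [dist_eq_norm] at h2
            simp only [hq, h2] at hpos'
            linarith
        obtain ⟨ρ, hρ, hsub⟩ := hu.submean z₁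
        have hd : 0 < r - dist z₁ z₀ := by
          have := mem_ball.1 hz₁b
          linarith
        obtain ⟨s, hs0, hs⟩ := exists_between (lt_min hρ hd)
        -- On the circle of radius s about z₁, |w - z₀|² equals |z₁ - z₀|² + s² plus a term linear
        -- in w - z₁. So there q + (a - q z₁) is the real part of the entire function G, whereas at
        -- the centre Re G is only a - δs².
        set G : ℂ → ℂ := fun w => H w + (δ : ℂ) * ((r : ℂ) ^ 2 - (‖z₁ - z₀‖ : ℂ) ^ 2 - (s : ℂ) ^ 2
          - 2 * (starRingEnd ℂ (z₁ - z₀)) * (w - z₁)) + ((a - q z₁ : ℝ) : ℂ) with hG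
        have hGd : Differentiable ℂ G := by
          simp only [hG]
          fun_prop
        have hGre : ∀ w, (G w).re = (H w).re + δ * (r ^ 2 - ‖z₁ - z₀‖ ^ 2 - s ^ 2 -
            2 * (starRingEnd ℂ (z₁ - z₀) * (w - z₁)).re) + (a - q z₁) := by
          intro w
          simp only [hG, Complex.add_re, Complex.ofReal_re, ← Complex.ofReal_pow,
            Complex.ofReal_im, Complex.sub_re, mul_assoc, Complex.mul_re, Complex.re_ofNat,
            Complex.im_ofNat]
          ring
        have h4 : circleMean u z₁ s ≤ ((G z₁).re : EReal) := by
          refine circleMean_le_re hGd hs0 fun w hw => ?_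
          have hwr : w ∈ closedBall z₀ r := by
            have h5 : dist w z₁ = s := hw
            have h6 := dist_triangle w z₁ z₀
            have h7 := hs.trans_le (min_le_right _ _)
            rw [mem_closedBall]; linarith
          have h8 := hmax hwr
          have hnw : ‖w - z₀‖ ^ 2 = ‖z₁ - z₀‖ ^ 2 + s ^ 2 +
              2 * (starRingEnd ℂ (z₁ - z₀) * (w - z₁)).re := by
            have h5 : ‖w - z₁‖ = s := by rw [← dist_eq_norm]; exact hw
            rw [← h5, ← Complex.normSq_eq_norm_sq, ← Complex.normSq_eq_norm_sq,
              ← Complex.normSq_eq_norm_sq]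
            simp only [Complex.normSq_apply, Complex.mul_re, Complex.conj_re, Complex.conj_im,
              Complex.sub_re, Complex.sub_im]
            ring
          have hnew := (hu.lt_top w).ne
          induction h9 : u w with
          | bot => exact bot_le
          | top => exact absurd h9 hnew
          | coe b =>
            simp only [h9, h1, mem_ofPred_eq] at h8
            have h8' : b + -q w ≤ a + -q z₁ := by exact_mod_cast h8
            have : b ≤ (G w).re := by
              rw [hGre]
              simp only [hq] at h8' ⊢
              rw [hnw] at h8'
              linarith
            exact_mod_cast this
        have h5 := (hsub s hs0 (hs.trans_le (min_le_left _ _))).trans h4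
        rw [h1] at h5
        have h5' : a ≤ (G z₁).re := by exact_mod_cast h5
        rw [hGre] at h5'
        simp only [hq, sub_self, mul_zero, Complex.zero_re] at h5'
        have : 0 < δ * s ^ 2 := by positivity
        linarith
  have hlim : Tendsto (fun δ : ℝ => (((H z₀).re + δ * r ^ 2 : ℝ) : EReal)) (𝓝[>] 0)
      (𝓝 ((H z₀).re : EReal)) := by
    have : Continuous fun δ : ℝ => (((H z₀).re + δ * r ^ 2 : ℝ) : EReal) :=
      continuous_coe_real_ereal.comp (by fun_prop)
    have h2 := (this.tendsto 0).mono_left (nhdsWithin_le_nhds (s := Ioi 0))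
    simpa using h2
  exact ge_of_tendsto hlim (eventually_mem_nhdsWithin.mono fun δ hδ => key δ hδ)

/-- A bounded upper semicontinuous function on a metric space is the pointwise limit of continuous
functions that lie above it. -/
theorem UpperSemicontinuous.exists_continuous_tendsto {X : Type*} [PseudoMetricSpace X] {w : X → ℝ}
    (hw : UpperSemicontinuous w) {a b : ℝ} (ha : ∀ x, a ≤ w x) (hb : ∀ x, w x ≤ b) :
    ∃ ψ : ℕ → X → ℝ, (∀ n, Continuous (ψ n)) ∧ (∀ n x, w x ≤ ψ n x) ∧ (∀ n x, ψ n x ≤ b) ∧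
      ∀ x, Tendsto (fun n => ψ n x) atTop (𝓝 (w x)) := by
  have hbdd : ∀ (n : ℕ) (x : X), BddAbove (range fun y => w y - n * dist x y) := fun n x =>
    ⟨b, by rintro _ ⟨y, rfl⟩; have := hb y; have : 0 ≤ (n : ℝ) * dist x y := by positivity
           simp only; linarith [hb y]⟩
  have hle : ∀ (n : ℕ) (x : X), w x ≤ ⨆ y, (w y - n * dist x y) := fun n x => by
    have := le_ciSup (hbdd n x) x
    simpa using this
  have hleb : ∀ (n : ℕ) (x : X), (⨆ y, (w y - n * dist x y)) ≤ b := fun n x => by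
    have : Nonempty X := ⟨x⟩
    refine ciSup_le fun y => ?_
    have : 0 ≤ (n : ℝ) * dist x y := by positivity
    linarith [hb y]
  -- Sup-convolution with a cone of slope n: it is n-Lipschitz and lies above w.
  refine ⟨fun n x => ⨆ y, (w y - n * dist x y), fun n => ?_, hle, hleb, fun x => ?_⟩
  · refine (LipschitzWith.of_dist_le_mul (K := (n : NNReal)) fun x x' => ?_).continuous
    have aux : ∀ x x' : X, (⨆ y, (w y - n * dist x y)) ≤
        (⨆ y, (w y - n * dist x' y)) + n * dist x x' := fun x x' => by
      have : Nonempty X := ⟨x⟩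
      refine ciSup_le fun y => ?_
      have h1 := le_ciSup (hbdd n x') y
      have h2 : dist x' y ≤ dist x x' + dist x y := by
        rw [dist_comm x x']; exact dist_triangle x' x y
      have h3 : (n : ℝ) * dist x' y ≤ n * dist x x' + n * dist x y := by
        rw [← mul_add]; exact mul_le_mul_of_nonneg_left h2 (Nat.cast_nonneg n)
      linarith
    rw [Real.dist_eq, abs_le]
    have h1 := aux x x'
    have h2 := aux x' x
    rw [dist_comm x' x] at h2
    constructor <;> simp only [NNReal.coe_natCast] <;> linarith
  · rw [Metric.tendsto_atTop]
    intro ε hε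
    obtain ⟨η, hη, hη'⟩ := Metric.eventually_nhds_iff.1 (hw x (w x + ε / 2) (by linarith))
    -- From this slope on, the penalty beyond distance η exceeds the total oscillation b - a, so
    -- only points near x matter.
    obtain ⟨N, hN⟩ := exists_nat_gt ((b - a) / η)
    refine ⟨N, fun n hn => ?_⟩
    have : Nonempty X := ⟨x⟩
    have h1 : (⨆ y, (w y - n * dist x y)) ≤ w x + ε / 2 := by
      refine ciSup_le fun y => ?_
      have hn0 : 0 ≤ (n : ℝ) * dist x y := by positivity
      by_cases hy : dist y x < η
      · linarith [hη' hy]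
      · rw [div_lt_iff₀ hη] at hN
        have h2 : (N : ℝ) * η ≤ n * dist x y := by
          rw [dist_comm]
          exact mul_le_mul (by exact_mod_cast hn) (not_lt.1 hy) hη.le (Nat.cast_nonneg n)
        linarith [ha x, hb y]
    rw [Real.dist_eq, abs_lt]
    constructor <;> linarith [hle n x]

/-- The real part of a continuous function on a circle is uniformly approximated by the real parts
of entire functions. -/
theorem exists_differentiable_re_approx {ψ : ℂ → ℝ} (hψ : Continuous ψ) (z₀ : ℂ) {r : ℝ}
    (hr : 0 < r) {δ : ℝ} (hδ : 0 < δ) :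
    ∃ H : ℂ → ℂ, Differentiable ℂ H ∧ ∀ w ∈ sphere z₀ r, |(H w).re - ψ w| < δ := by
  have : Fact (0 < 2 * Real.pi) := ⟨by positivity⟩
  have hper : Function.Periodic (fun t : ℝ => (ψ (circleMap z₀ r t) : ℂ)) (2 * Real.pi) :=
    fun t => by simp only [periodic_circleMap z₀ r t]
  have hcont : Continuous hper.lift := by
    refine continuous_coinduced_dom.2 ?_
    exact Complex.continuous_ofReal.comp (hψ.comp (continuous_circleMap z₀ r))
  have hmem : (⟨hper.lift, hcont⟩ : C(AddCircle (2 * Real.pi), ℂ)) ∈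
      (Submodule.span ℂ (range <| @fourier (2 * Real.pi))).topologicalClosure := by
    rw [span_fourier_closure_eq_top]; trivial
  obtain ⟨p, hp, hpd⟩ := Metric.mem_closure_iff.1 hmem δ hδ
  -- On the circle, e^{int} is a power of (w - z₀)/r for n ≥ 0 and the conjugate of one for n ≤ 0.
  have hrep : ∃ H₁ H₂ : ℂ → ℂ, Differentiable ℂ H₁ ∧ Differentiable ℂ H₂ ∧ ∀ t : ℝ,
      p (t : AddCircle (2 * Real.pi)) =
        H₁ (circleMap z₀ r t) + starRingEnd ℂ (H₂ (circleMap z₀ r t)) := by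
    have hr' : (r : ℂ) ≠ 0 := by exact_mod_cast hr.ne'
    have hπ : (Real.pi : ℂ) ≠ 0 := by exact_mod_cast Real.pi_ne_zero
    clear hpd
    induction hp using Submodule.span_induction with
    | mem x hx =>
      obtain ⟨n, rfl⟩ := hx
      have hexp : ∀ (m : ℕ) (t : ℝ), ((circleMap z₀ r t - z₀) / r) ^ m =
          Complex.exp (m * (t * Complex.I)) := fun m t => by
        rw [circleMap_sub_center, circleMap_zero, mul_div_cancel_left₀ _ hr', ← Complex.exp_nat_mul]
      rcases n.eq_nat_or_neg with ⟨m, rfl | rfl⟩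
      · refine ⟨fun w => ((w - z₀) / r) ^ m, 0, by fun_prop, by fun_prop, fun t => ?_⟩
        rw [fourier_coe_apply]
        simp only [hexp, Pi.zero_apply, map_zero, add_zero]
        congr 1
        push_cast
        field_simp
      · refine ⟨0, fun w => ((w - z₀) / r) ^ m, by fun_prop, by fun_prop, fun t => ?_⟩
        rw [fourier_coe_apply]
        simp only [hexp, ← Complex.exp_conj, Pi.zero_apply, zero_add, map_mul, Complex.conj_I, Complex.conj_ofReal,
          map_natCast]
        congr 1
        push_cast
        field_simp
    | zero => exact ⟨0, 0, by fun_prop, by fun_prop, fun t => by simp⟩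
    | add x y _ _ hx hy =>
      obtain ⟨H₁, H₂, h1, h2, h⟩ := hx
      obtain ⟨G₁, G₂, g1, g2, g⟩ := hy
      refine ⟨H₁ + G₁, H₂ + G₂, h1.add g1, h2.add g2, fun t => ?_⟩
      simp only [ContinuousMap.add_apply, h, g, Pi.add_apply, map_add]
      ring
    | smul c x _ hx =>
      obtain ⟨H₁, H₂, h1, h2, h⟩ := hx
      refine ⟨fun w => c * H₁ w, fun w => starRingEnd ℂ c * H₂ w, by fun_prop, by fun_prop,
        fun t => ?_⟩
      simp only [ContinuousMap.smul_apply, h, smul_eq_mul, map_mul, Complex.conj_conj]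
      ring
  obtain ⟨H₁, H₂, h1, h2, h⟩ := hrep
  -- Real parts do not see the conjugation, so H₂ may replace its conjugate.
  refine ⟨fun w => H₁ w + H₂ w, h1.add h2, fun w hw => ?_⟩
  obtain ⟨t, rfl⟩ : ∃ t, circleMap z₀ r t = w := by
    have : w ∈ range (circleMap z₀ r) := by
      rw [range_circleMap, abs_of_pos hr]; exact hw
    exact this
  have h3 := (ContinuousMap.dist_apply_le_dist (t : AddCircle (2 * Real.pi))).trans_lt hpd
  rw [h t, dist_comm, Complex.dist_eq] at h3
  refine (le_trans (le_of_eq ?_) (Complex.abs_re_le_norm _)).trans_lt h3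
  have h4 : hper.lift (t : AddCircle (2 * Real.pi)) = (ψ (circleMap z₀ r t) : ℂ) := rfl
  simp only [ContinuousMap.coe_mk, h4, Complex.sub_re, Complex.add_re, Complex.conj_re,
    Complex.ofReal_re]

/-- The real-valued truncation of `x` to the interval between `-M` and `C`. -/
noncomputable def truncReal (C M : ℝ) (x : EReal) : ℝ := (max (min x C) ((-M : ℝ) : EReal)).toReal

theorem coe_truncReal (C M : ℝ) (x : EReal) :
    (truncReal C M x : EReal) = max (min x C) ((-M : ℝ) : EReal) := by
  refine EReal.coe_toReal (ne_of_lt ?_) (ne_of_gt ?_)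
  · exact max_lt ((min_le_right _ _).trans_lt (EReal.coe_lt_top _)) (EReal.coe_lt_top _)
  · exact (EReal.bot_lt_coe _).trans_le (le_max_right _ _)

theorem upperSemicontinuous_truncReal {X : Type*} [TopologicalSpace X] {u : X → EReal}
    (hu : UpperSemicontinuous u) (C M : ℝ) : UpperSemicontinuous fun x => truncReal C M (u x) := by
  have h1 : UpperSemicontinuous fun x => max (min (u x) C) ((-M : ℝ) : EReal) :=
    (hu.inf upperSemicontinuous_const).sup upperSemicontinuous_const
  intro x y hy
  have h2 := h1 x y (by
    show max (min (u x) C) ((-M : ℝ) : EReal) < y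
    rw [← coe_truncReal]; exact_mod_cast hy)
  filter_upwards [h2] with x' hx'
  rw [← coe_truncReal] at hx'
  exact_mod_cast hx'

theorem truncReal_coe {C M b : ℝ} (hC : b ≤ C) (hM : -M ≤ b) : truncReal C M (b : EReal) = b := by
  have : (truncReal C M (b : EReal) : EReal) = b := by
    rw [coe_truncReal, min_eq_left (by exact_mod_cast hC), max_eq_left (by exact_mod_cast hM)]
  exact_mod_cast this

theorem truncReal_bot (C M : ℝ) : truncReal C M ⊥ = -M := by
  have : (truncReal C M (⊥ : EReal) : EReal) = (-M : ℝ) := by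
    rw [coe_truncReal, min_eq_left bot_le, max_eq_right bot_le]
  exact_mod_cast this

theorem truncReal_le {C M : ℝ} (hM : -M ≤ C) (x : EReal) : truncReal C M x ≤ C := by
  have : (truncReal C M x : EReal) ≤ C := by
    rw [coe_truncReal]
    exact max_le (min_le_right _ _) (by exact_mod_cast hM)
  exact_mod_cast this

theorem neg_le_truncReal (C M : ℝ) (x : EReal) : -M ≤ truncReal C M x := by
  have : ((-M : ℝ) : EReal) ≤ truncReal C M x := by
    rw [coe_truncReal]
    exact le_max_right _ _
  exact_mod_cast this

theorem truncReal_anti {C M M' : ℝ} (h : M ≤ M') (x : EReal) :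
    truncReal C M' x ≤ truncReal C M x := by
  have : (truncReal C M' x : EReal) ≤ truncReal C M x := by
    rw [coe_truncReal, coe_truncReal]
    exact max_le_max le_rfl (by exact_mod_cast neg_le_neg h)
  exact_mod_cast this

/-- Continuous majorants decrease to the truncation; each is nearly the real part of an entire
function on the circle, to which the maximum principle applies. The truncation makes everything
bounded, so dominated convergence finishes. -/
theorem IsSubharmonic.le_circleAverage_truncReal {u : ℂ → EReal} (hu : IsSubharmonic u) {z : ℂ}
    {r : ℝ} (hr : 0 < r) {C M a : ℝ} (hC : ∀ w ∈ sphere z r, u w ≤ C) (hM : -M ≤ C)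
    (ha : u z = a) : a ≤ Real.circleAverage (fun w => truncReal C M (u w)) z r := by
  obtain ⟨ψ, hψc, hψ, hψb, hψt⟩ :=
    (upperSemicontinuous_truncReal hu.upperSemicontinuous C M).exists_continuous_tendsto
      (fun x => neg_le_truncReal C M (u x)) (fun x => truncReal_le hM (u x))
  have h1 : ∀ n, a ≤ Real.circleAverage (ψ n) z r := by
    intro n
    refine le_of_forall_pos_le_add fun δ hδ => ?_
    -- Approximating ψ + δ/2 within δ/2 puts Re H strictly between ψ and ψ + δ on the circle.
    obtain ⟨H, hH, hHψ⟩ := exists_differentiable_re_approx (ψ := fun w => ψ n w + δ / 2)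
      ((hψc n).add continuous_const) z hr (half_pos hδ)
    have h2 : u z ≤ ((H z).re : EReal) := by
      refine hu.le_re_of_lt_on_sphere hH hr fun w hw => ?_
      have h3 := (abs_lt.1 (hHψ w hw)).1
      have h4 : u w ≤ (truncReal C M (u w) : EReal) := by
        rw [coe_truncReal, min_eq_left (hC w hw)]; exact le_max_left _ _
      refine h4.trans_lt ?_
      have := hψ n w
      exact_mod_cast (by linarith : truncReal C M (u w) < (H w).re)
    rw [ha] at h2
    have h2' : a ≤ (H z).re := by exact_mod_cast h2
    have h5 : Real.circleAverage (Complex.reCLM ∘ H) z r = (H z).re := by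
      rw [Complex.reCLM.circleAverage_comp_comm, hH.diffContOnCl.circleAverage]
      · rfl
      · exact hH.continuous.continuousOn.circleIntegrable'
    have h6 : Real.circleAverage (Complex.reCLM ∘ H) z r ≤
        Real.circleAverage (fun w => ψ n w + δ) z r := by
      refine Real.circleAverage_mono ?_ ?_ fun w hw => ?_
      · exact (Complex.reCLM.continuous.comp hH.continuous).continuousOn.circleIntegrable'
      · exact ((hψc n).add continuous_const).continuousOn.circleIntegrable'
      · rw [abs_of_pos hr] at hw
        have h3 := (abs_lt.1 (hHψ w hw)).2
        simp only [Function.comp_apply, Complex.reCLM_apply]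
        linarith
    rw [Real.circleAverage_fun_add ((hψc n).continuousOn.circleIntegrable')
      (continuous_const.continuousOn.circleIntegrable'), Real.circleAverage_const] at h6
    linarith
  have hlim : Tendsto (fun n => Real.circleAverage (ψ n) z r) atTop
      (𝓝 (Real.circleAverage (fun w => truncReal C M (u w)) z r)) := by
    simp only [Real.circleAverage_def]
    refine Tendsto.const_smul ?_ _
    refine intervalIntegral.tendsto_integral_filter_of_dominated_convergence
      (fun _ => max |C| |M|) ?_ ?_ ?_ ?_
    · exact Eventually.of_forall fun n =>
        ((hψc n).comp (continuous_circleMap z r)).aestronglyMeasurable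
    · refine Eventually.of_forall fun n => ae_of_all _ fun t _ => ?_
      rw [Real.norm_eq_abs]
      have h2 := hψ n (circleMap z r t)
      have h3 := hψb n (circleMap z r t)
      have h4 := neg_le_truncReal C M (u (circleMap z r t))
      refine abs_le.2 ⟨?_, ?_⟩
      · linarith [le_max_right |C| |M|, neg_abs_le M, le_abs_self M]
      · linarith [le_max_left |C| |M|, le_abs_self C]
    · simp
    · exact ae_of_all _ fun t _ => hψt _
  exact ge_of_tendsto' hlim h1

theorem IsSubharmonic.measurable {u : ℂ → EReal} (hu : IsSubharmonic u) : Measurable u :=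
  hu.upperSemicontinuous.measurable

/-- The submean inequality on all circles, for the nonnegative function `C - u`. -/
theorem IsSubharmonic.lintegral_circle_le {u : ℂ → EReal} (hu : IsSubharmonic u) {z : ℂ}
    {r : ℝ} (hr : 0 < r) {C : ℝ} (hC : ∀ w ∈ sphere z r, u w ≤ C) :
    ∫⁻ t in Ioc 0 (2 * Real.pi), ((C : EReal) - u (circleMap z r t)).toENNReal ≤
      ENNReal.ofReal (2 * Real.pi) * ((C : EReal) - u z).toENNReal := by
  have hπ : 0 < 2 * Real.pi := by positivity
  induction ha : u z with
  | bot =>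
    rw [EReal.coe_sub_bot, EReal.toENNReal_top, ENNReal.mul_top]
    · exact le_top
    · simp [Real.pi_pos]
  | top => exact absurd ha (hu.lt_top z).ne
  | coe a =>
    set w : ℕ → ℝ → ℝ := fun M t => truncReal C M (u (circleMap z r t)) with hw
    have hmeas : ∀ M, Measurable (w M) := fun M =>
      ((upperSemicontinuous_truncReal hu.upperSemicontinuous C M).measurable).comp
        (continuous_circleMap z r).measurable
    -- Monotone convergence as the lower truncation level -M tends to -∞.
    have hlim : Tendsto (fun M => ∫⁻ t in Ioc 0 (2 * Real.pi), ENNReal.ofReal (C - w M t)) atTop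
        (𝓝 (∫⁻ t in Ioc 0 (2 * Real.pi), ((C : EReal) - u (circleMap z r t)).toENNReal)) := by
      refine lintegral_tendsto_of_tendsto_of_monotone
        (fun M => ((hmeas M).const_sub C).ennreal_ofReal.aemeasurable) ?_ ?_
      · refine ae_of_all _ fun t M M' h => ENNReal.ofReal_le_ofReal ?_
        have := truncReal_anti (C := C) (M := M) (M' := M') (by exact_mod_cast h)
          (u (circleMap z r t))
        simp only [hw]
        linarith
      · refine ae_of_all _ fun t => ?_
        have hct := hC _ (circleMap_mem_sphere z hr.le t)
        induction hb : u (circleMap z r t) with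
        | bot =>
          simp only [hw, hb, truncReal_bot, EReal.coe_sub_bot, EReal.toENNReal_top]
          refine ENNReal.tendsto_ofReal_atTop.comp ?_
          simp only [sub_neg_eq_add]
          exact tendsto_atTop_add_const_left _ _ tendsto_natCast_atTop_atTop
        | top => exact absurd hb (hu.lt_top _).ne
        | coe b =>
          rw [hb] at hct
          have hct' : b ≤ C := by exact_mod_cast hct
          refine tendsto_const_nhds.congr' ?_
          obtain ⟨N, hN⟩ := exists_nat_ge (-b)
          filter_upwards [eventually_ge_atTop N] with M hM
          have : (N : ℝ) ≤ M := by exact_mod_cast hM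
          simp only [hw, hb]
          rw [truncReal_coe hct' (by linarith), ← EReal.coe_sub, EReal.toENNReal_of_ne_top
            (EReal.coe_ne_top _), EReal.toReal_coe]
    refine le_of_tendsto hlim ?_
    obtain ⟨N, hN⟩ := exists_nat_ge (-C)
    filter_upwards [eventually_ge_atTop N] with M hM
    have hM' : (N : ℝ) ≤ M := by exact_mod_cast hM
    have hMC : -(M : ℝ) ≤ C := by linarith
    have h1 := hu.le_circleAverage_truncReal hr hC hMC ha
    have hint : IntegrableOn (w M) (Ioc 0 (2 * Real.pi)) := by
      refine Measure.integrableOn_of_bounded (M := max |C| |(M : ℝ)|) measure_Ioc_lt_top.ne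
        (hmeas M).aestronglyMeasurable (ae_of_all _ fun t => ?_)
      rw [Real.norm_eq_abs]
      have h4 := neg_le_truncReal C M (u (circleMap z r t))
      have h5 := truncReal_le hMC (u (circleMap z r t))
      refine abs_le.2 ⟨?_, ?_⟩
      · linarith [le_max_right |C| |(M : ℝ)|, neg_abs_le (M : ℝ), le_abs_self (M : ℝ)]
      · linarith [le_max_left |C| |(M : ℝ)|, le_abs_self C]
    have hint2 : IntegrableOn (fun t => C - w M t) (Ioc 0 (2 * Real.pi)) :=
      (integrable_const C).sub hint
    rw [← ofReal_integral_eq_lintegral_ofReal hint2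
      (ae_of_all _ fun t => sub_nonneg.2 (truncReal_le hMC _)), ← EReal.coe_sub,
      EReal.toENNReal_of_ne_top (EReal.coe_ne_top _), EReal.toReal_coe,
      ← ENNReal.ofReal_mul hπ.le]
    refine ENNReal.ofReal_le_ofReal ?_
    rw [Real.circleAverage_def, intervalIntegral.integral_of_le hπ.le, smul_eq_mul,
      inv_mul_eq_div, le_div_iff₀ hπ] at h1
    rw [integral_sub (integrable_const C) hint]
    simp only [integral_const, measureReal_restrict_apply, MeasurableSet.univ, univ_inter,
      Real.volume_real_Ioc_of_le hπ.le, smul_eq_mul]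
    simp only [hw]
    linarith

/-! ### Polar coordinates, area means and local integrability -/

theorem Function.Periodic.setLIntegral_Ioc_eq {f : ℝ → ENNReal} {T : ℝ} (hf : Function.Periodic f T)
    (hT : 0 < T) (a b : ℝ) : ∫⁻ t in Ioc a (a + T), f t = ∫⁻ t in Ioc b (b + T), f t := by
  refine (isAddFundamentalDomain_Ioc hT a).setLIntegral_eq (isAddFundamentalDomain_Ioc hT b) f ?_
  rintro ⟨g, hg⟩ x
  obtain ⟨n, rfl⟩ := AddSubgroup.mem_zmultiples_iff.1 hg
  show f ((n • T) + x) = f x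
  rw [add_comm]
  exact hf.zsmul n x

theorem lintegral_eq_lintegral_circleMap {f : ℂ → ENNReal} (hf : Measurable f) (z : ℂ) :
    ∫⁻ w, f w = ∫⁻ r in Ioi (0 : ℝ), ENNReal.ofReal r *
      ∫⁻ t in Ioc 0 (2 * Real.pi), f (circleMap z r t) := by
  have h0 : ∫⁻ w, f w = ∫⁻ w, f (z + w) := (lintegral_add_left_eq_self f z).symm
  have hm : Measurable fun p : ℝ × ℝ => ENNReal.ofReal p.1 * f (circleMap z p.1 p.2) := by
    refine measurable_fst.ennreal_ofReal.mul (hf.comp ?_)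
    have : Continuous fun p : ℝ × ℝ => circleMap z p.1 p.2 := by
      simp only [circleMap]; fun_prop
    exact this.measurable
  rw [h0, ← Complex.lintegral_comp_polarCoord_symm, polarCoord_target, Measure.volume_eq_prod,
    ← Measure.prod_restrict]
  have h1 : ∀ p : ℝ × ℝ, ENNReal.ofReal p.1 • f (z + Complex.polarCoord.symm p) =
      ENNReal.ofReal p.1 * f (circleMap z p.1 p.2) := fun p => by
    rw [Complex.polarCoord_symm_apply, smul_eq_mul, circleMap, Complex.exp_mul_I,
      Complex.ofReal_cos, Complex.ofReal_sin]
  simp only [h1]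
  rw [lintegral_prod _ hm.aemeasurable]
  refine lintegral_congr fun r => ?_
  dsimp only
  rw [lintegral_const_mul _ (by
    exact hf.comp (continuous_circleMap z r).measurable), restrict_Ioo_eq_restrict_Ioc]
  congr 1
  have hper : Function.Periodic (fun t => f (circleMap z r t)) (2 * Real.pi) :=
    fun t => by simp only [periodic_circleMap z r t]
  have := hper.setLIntegral_Ioc_eq (by positivity) (-Real.pi) 0
  rw [show -Real.pi + 2 * Real.pi = Real.pi by ring, zero_add] at this
  exact this

/-- Integrates the circle inequality in polar coordinates. It is required only at radii where k does
not vanish, because the bound u ≤ C is available only on a bounded disc. -/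
theorem lintegral_radial_mul_le {N : ℂ → ENNReal} (hN : Measurable N) {k : ℝ → ENNReal}
    (hk : Measurable k) {z : ℂ} {A : ENNReal}
    (h : ∀ r, 0 < r → k r ≠ 0 →
      ∫⁻ t in Ioc 0 (2 * Real.pi), N (circleMap z r t) ≤ ENNReal.ofReal (2 * Real.pi) * A) :
    ∫⁻ w, k ‖w - z‖ * N w ≤ (∫⁻ w : ℂ, k ‖w‖) * A := by
  have hkz : Measurable fun w : ℂ => k ‖w - z‖ := hk.comp (by fun_prop)
  have h1 : ∫⁻ w : ℂ, k ‖w‖ = ∫⁻ w, k ‖w - z‖ :=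
    (lintegral_sub_right_eq_self (fun w : ℂ => k ‖w‖) z).symm
  rw [h1, lintegral_eq_lintegral_circleMap (f := fun w => k ‖w - z‖ * N w) (hkz.mul hN) z, lintegral_eq_lintegral_circleMap hkz z]
  have hmeas : Measurable fun r : ℝ => ENNReal.ofReal r *
      ∫⁻ t in Ioc 0 (2 * Real.pi), k ‖circleMap z r t - z‖ := by
    simp only [circleMap_sub_center, norm_circleMap_zero, lintegral_const]
    have : Measurable fun r : ℝ => k |r| := hk.comp (by fun_prop)
    fun_prop
  rw [← lintegral_mul_const _ hmeas]
  refine lintegral_mono_ae ?_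
  filter_upwards [ae_restrict_mem measurableSet_Ioi] with r hr
  have hr0 : |r| = r := abs_of_pos hr
  simp only [circleMap_sub_center, norm_circleMap_zero, hr0]
  have hNr : Measurable fun t => N (circleMap z r t) :=
    hN.comp (continuous_circleMap z r).measurable
  rw [lintegral_const_mul _ hNr, lintegral_const,
    mul_assoc]
  refine mul_le_mul_right ?_ _
  by_cases hk0 : k r = 0
  · simp [hk0]
  · have := h r hr hk0
    simp only [Measure.restrict_apply MeasurableSet.univ, univ_inter, Real.volume_Ioc, sub_zero]
    rw [mul_assoc]
    exact mul_le_mul_right this _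

theorem IsSubharmonic.exists_le_coe {u : ℂ → EReal} (hu : IsSubharmonic u) {S : Set ℂ}
    (hS : IsCompact S) : ∃ C : ℝ, ∀ w ∈ S, u w ≤ C := by
  rcases S.eq_empty_or_nonempty with rfl | hne
  · exact ⟨0, by simp⟩
  obtain ⟨w₀, _, hw₀⟩ := UpperSemicontinuousOn.exists_isMaxOn hne hS
    (hu.upperSemicontinuous.upperSemicontinuousOn S)
  induction h : u w₀ with
  | bot => exact ⟨0, fun w hw => (hw₀ hw).trans (by rw [h]; exact bot_le)⟩
  | top => exact absurd h (hu.lt_top _).ne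
  | coe a => exact ⟨a, fun w hw => (hw₀ hw).trans (by rw [h])⟩

theorem IsSubharmonic.measurable_toENNReal {u : ℂ → EReal} (hu : IsSubharmonic u) (C : ℝ) :
    Measurable fun w => ((C : EReal) - u w).toENNReal :=
  (measurable_const.sub hu.measurable).ereal_toENNReal

theorem EReal.toENNReal_coe_sub {C : ℝ} {x : EReal} (hx : x ≠ ⊥) (hx' : x ≠ ⊤) :
    ((C : EReal) - x).toENNReal = ENNReal.ofReal (C - x.toReal) := by
  induction x with
  | bot => exact absurd rfl hx
  | top => exact absurd rfl hx'
  | coe b =>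
    rw [← EReal.coe_sub, EReal.toENNReal_of_ne_top (EReal.coe_ne_top _), EReal.toReal_coe,
      EReal.toReal_coe]

theorem EReal.toReal_le_of_le_coe {x : EReal} {C : ℝ} (hx : x ≠ ⊥) (h : x ≤ C) : x.toReal ≤ C := by
  rw [← EReal.coe_le_coe_iff]
  exact (EReal.coe_toReal (ne_top_of_le_ne_top (EReal.coe_ne_top C) h) hx).le.trans h

theorem IsSubharmonic.lintegral_closedBall_lt_top {u : ℂ → EReal} (hu : IsSubharmonic u) {z : ℂ}
    (hz : u z ≠ ⊥) {R C : ℝ} (hC : ∀ w ∈ closedBall z R, u w ≤ C) :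
    ∫⁻ w in closedBall z R, ((C : EReal) - u w).toENNReal < ⊤ := by
  have h1 := lintegral_radial_mul_le (hu.measurable_toENNReal C)
    (k := (Iic R).indicator 1) (measurable_one.indicator measurableSet_Iic) (z := z)
    (A := ((C : EReal) - u z).toENNReal) (fun r hr hk => by
      refine hu.lintegral_circle_le hr fun w hw => hC w ?_
      have : r ≤ R := by
        by_contra hcon
        exact hk (indicator_of_notMem (by simpa using hcon) _)
      rw [mem_closedBall, mem_sphere.1 hw]; exact this)
  have h2 : ∫⁻ w in closedBall z R, ((C : EReal) - u w).toENNReal =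
      ∫⁻ w, (Iic R).indicator 1 ‖w - z‖ * ((C : EReal) - u w).toENNReal := by
    rw [← lintegral_indicator measurableSet_closedBall]
    refine lintegral_congr fun w => ?_
    by_cases hw : w ∈ closedBall z R
    · have hw' : ‖w - z‖ ∈ Iic R := by rw [mem_Iic, ← dist_eq_norm]; exact hw
      simp [indicator_of_mem hw, indicator_of_mem hw']
    · have hw' : ‖w - z‖ ∉ Iic R := by rw [mem_Iic, ← dist_eq_norm]; exact hw
      simp [indicator_of_notMem hw, indicator_of_notMem hw']
  rw [h2]
  refine h1.trans_lt (ENNReal.mul_lt_top ?_ ?_)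
  · have h3 : ∫⁻ w : ℂ, (Iic R).indicator 1 ‖w‖ = volume (closedBall (0 : ℂ) R) := by
      rw [← lintegral_indicator_one measurableSet_closedBall]
      refine lintegral_congr fun w => ?_
      simp [indicator]
    rw [h3]
    exact measure_closedBall_lt_top
  · rw [EReal.toENNReal_coe_sub hz (hu.lt_top z).ne]
    exact ENNReal.ofReal_lt_top

/-- On every disc about one point where u is finite, C - u has finite integral, hence is finite
almost everywhere; these discs exhaust the plane. -/
theorem IsSubharmonic.ae_ne_bot {u : ℂ → EReal} (hu : IsSubharmonic u) (hne : ∃ z, u z ≠ ⊥) :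
    ∀ᵐ w, u w ≠ ⊥ := by
  obtain ⟨z, hz⟩ := hne
  have h1 : ∀ n : ℕ, ∀ᵐ w, w ∈ closedBall z n → u w ≠ ⊥ := by
    intro n
    obtain ⟨C, hC⟩ := hu.exists_le_coe (isCompact_closedBall z n)
    have h2 := ae_lt_top (hu.measurable_toENNReal C) (hu.lintegral_closedBall_lt_top hz hC).ne
    rw [ae_restrict_iff' measurableSet_closedBall] at h2
    filter_upwards [h2] with w hw hwn hbot
    have := hw hwn
    rw [hbot, EReal.coe_sub_bot, EReal.toENNReal_top] at this
    exact lt_irrefl _ this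
  filter_upwards [ae_all_iff.2 h1] with w hw
  obtain ⟨n, hn⟩ := exists_nat_ge (dist w z)
  exact hw n hn

theorem IsSubharmonic.locallyIntegrable {u : ℂ → EReal} (hu : IsSubharmonic u)
    (hne : ∃ z, u z ≠ ⊥) : LocallyIntegrable fun w => (u w).toReal := by
  have hae := hu.ae_ne_bot hne
  obtain ⟨z, hz⟩ := hne
  rw [locallyIntegrable_iff]
  intro S hS
  obtain ⟨R, hR⟩ := hS.isBounded.subset_closedBall z
  refine IntegrableOn.mono_set ?_ hR
  obtain ⟨C, hC⟩ := hu.exists_le_coe (isCompact_closedBall z R)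
  have h1 : IntegrableOn (fun w => C - (u w).toReal) (closedBall z R) := by
    refine ⟨(measurable_const.sub hu.measurable.ereal_toReal).aestronglyMeasurable, ?_⟩
    refine lt_of_le_of_lt (lintegral_mono_ae ?_) (hu.lintegral_closedBall_lt_top hz hC)
    filter_upwards [ae_restrict_mem measurableSet_closedBall, ae_restrict_of_ae hae] with w hw hb
    rw [EReal.toENNReal_coe_sub hb (hu.lt_top w).ne, Real.enorm_of_nonneg
      (sub_nonneg.2 (EReal.toReal_le_of_le_coe hb (hC w hw)))]
  have h2 : IntegrableOn (fun _ : ℂ => C) (closedBall z R) :=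
    integrableOn_const measure_closedBall_lt_top.ne
  exact (h2.sub h1).congr_fun (fun w _ => by simp) measurableSet_closedBall

/-- The submean inequality against a bounded radial weight of bounded support. -/
theorem IsSubharmonic.mul_integral_radial_le {u : ℂ → EReal} (hu : IsSubharmonic u) {z : ℂ}
    (hz : u z ≠ ⊥) {k : ℝ → ℝ} (hk : Measurable k) (hk0 : ∀ r, 0 ≤ k r) {B R : ℝ}
    (hkB : ∀ r, k r ≤ B) (hkR : ∀ r, R < r → k r = 0) :
    (u z).toReal * ∫ w : ℂ, k ‖w‖ ≤ ∫ w, (u w).toReal * k ‖w - z‖ := by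
  obtain ⟨C, hC⟩ := hu.exists_le_coe (isCompact_closedBall z (max R 0))
  have hae := hu.ae_ne_bot ⟨z, hz⟩
  have hkm : Measurable fun w : ℂ => k ‖w - z‖ := hk.comp (by fun_prop)
  have hsupp : ∀ w ∉ closedBall z (max R 0), k ‖w - z‖ = 0 := fun w hw => by
    refine hkR _ ?_
    rw [mem_closedBall, not_le, dist_eq_norm] at hw
    exact (le_max_left _ _).trans_lt hw
  have hbd : ∀ r, ‖k r‖ ≤ B := fun r => by rw [Real.norm_of_nonneg (hk0 r)]; exact hkB r
  have hgk : Integrable fun w => (u w).toReal * k ‖w - z‖ := by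
    have h1 : IntegrableOn (fun w => (u w).toReal * k ‖w - z‖) (closedBall z (max R 0)) :=
      Integrable.mul_bdd (c := B)
        ((hu.locallyIntegrable ⟨z, hz⟩).integrableOn_isCompact (isCompact_closedBall _ _))
        hkm.aestronglyMeasurable (ae_of_all _ fun w => hbd _)
    exact h1.integrable_of_forall_notMem_eq_zero fun w hw => by rw [hsupp w hw, mul_zero]
  have hki : Integrable fun w => k ‖w - z‖ := by
    have h1 : IntegrableOn (fun w => k ‖w - z‖) (closedBall z (max R 0)) :=
      Measure.integrableOn_of_bounded (M := B) measure_closedBall_lt_top.ne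
        hkm.aestronglyMeasurable (ae_of_all _ fun w => hbd _)
    exact h1.integrable_of_forall_notMem_eq_zero hsupp
  have hk1 : ∫ w : ℂ, k ‖w‖ = ∫ w, k ‖w - z‖ :=
    (integral_sub_right_eq_self (fun w : ℂ => k ‖w‖) z).symm
  have hkl : ∫⁻ w : ℂ, ENNReal.ofReal (k ‖w‖) = ENNReal.ofReal (∫ w, k ‖w - z‖) := by
    rw [ofReal_integral_eq_lintegral_ofReal hki (ae_of_all _ fun w => hk0 _)]
    exact (lintegral_sub_right_eq_self (fun w : ℂ => ENNReal.ofReal (k ‖w‖)) z).symm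
  have h1 := lintegral_radial_mul_le (hu.measurable_toENNReal C)
    (k := fun r => ENNReal.ofReal (k r)) hk.ennreal_ofReal (z := z)
    (A := ((C : EReal) - u z).toENNReal) (fun r hr hk => by
      refine hu.lintegral_circle_le hr fun w hw => hC w ?_
      have : r ≤ R := by
        by_contra hcon
        exact hk (by simp [hkR r (not_le.1 hcon)])
      rw [mem_closedBall, mem_sphere.1 hw]; exact this.trans (le_max_left _ _))
  have h2 : ∫⁻ w, ENNReal.ofReal (k ‖w - z‖) * ((C : EReal) - u w).toENNReal =
      ENNReal.ofReal (∫ w, (C * k ‖w - z‖ - (u w).toReal * k ‖w - z‖)) := by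
    have hint : Integrable fun w => C * k ‖w - z‖ - (u w).toReal * k ‖w - z‖ :=
      (hki.const_mul C).sub hgk
    rw [ofReal_integral_eq_lintegral_ofReal hint]
    · refine lintegral_congr_ae ?_
      filter_upwards [hae] with w hw
      rw [EReal.toENNReal_coe_sub hw (hu.lt_top w).ne, ← ENNReal.ofReal_mul (hk0 _)]
      congr 1; ring
    · filter_upwards [hae] with w hw
      by_cases hwb : w ∈ closedBall z (max R 0)
      · have := EReal.toReal_le_of_le_coe hw (hC w hwb)
        rw [← sub_mul]
        exact mul_nonneg (sub_nonneg.2 this) (hk0 _)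
      · simp [hsupp w hwb]
  have hza : (u z).toReal ≤ C :=
    EReal.toReal_le_of_le_coe hz (hC z (mem_closedBall_self (le_max_right _ _)))
  rw [h2, hkl, EReal.toENNReal_coe_sub hz (hu.lt_top z).ne, ← ENNReal.ofReal_mul
    (integral_nonneg fun w => hk0 _), ENNReal.ofReal_le_ofReal_iff (mul_nonneg
    (integral_nonneg fun w => hk0 _) (sub_nonneg.2 hza)),
    integral_sub (hki.const_mul C) hgk, integral_const_mul] at h1
  rw [hk1]
  linarith

/-- A subharmonic function is determined, up to inequality, by its values almost everywhere. -/
theorem IsSubharmonic.le_of_ae_le {u v : ℂ → EReal} (hu : IsSubharmonic u)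
    (hv : IsSubharmonic v) (h : ∀ᵐ w, u w ≤ v w) (z : ℂ) : u z ≤ v z := by
  by_contra hcon
  rw [not_le] at hcon
  obtain ⟨c, hc1, hc2⟩ := EReal.lt_iff_exists_real_btwn.1 hcon
  have hz : u z ≠ ⊥ := (bot_le.trans_lt hcon).ne'
  have hae := hu.ae_ne_bot ⟨z, hz⟩
  obtain ⟨η, hη, hη'⟩ := Metric.eventually_nhds_iff.1 (hv.upperSemicontinuous z c hc1)
  have hη2 : 0 < η / 2 := half_pos hη
  -- With this weight u(z) is at most the mean of u over a small disc, where u ≤ v < c almost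
  -- everywhere.
  set k : ℝ → ℝ := (Iic (η / 2)).indicator 1 with hk
  have hk0 : ∀ r, 0 ≤ k r := fun r => indicator_nonneg (fun _ _ => zero_le_one) r
  have hkn : ∀ w : ℂ, k ‖w - z‖ = (closedBall z (η / 2)).indicator 1 w := fun w => by
    simp only [hk, indicator, mem_Iic, mem_closedBall, dist_eq_norm, Pi.one_apply]
  have h1 := hu.mul_integral_radial_le hz (k := k) (measurable_one.indicator measurableSet_Iic)
    hk0 (B := 1) (R := η / 2)
    (fun r => indicator_le' (fun _ _ => le_rfl) (fun _ _ => zero_le_one) r)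
    (fun r hr => indicator_of_notMem (by simpa using hr) _)
  have hk1 : ∫ w : ℂ, k ‖w‖ = ∫ w, k ‖w - z‖ :=
    (integral_sub_right_eq_self (fun w : ℂ => k ‖w‖) z).symm
  have hpos : 0 < volume.real (closedBall z (η / 2)) :=
    ENNReal.toReal_pos (measure_closedBall_pos _ _ hη2).ne' measure_closedBall_lt_top.ne
  have hI : ∫ w, k ‖w - z‖ = volume.real (closedBall z (η / 2)) := by
    simp only [hkn]
    rw [integral_indicator_one measurableSet_closedBall]
  have h2 : ∫ w, (u w).toReal * k ‖w - z‖ ≤ c * volume.real (closedBall z (η / 2)) := by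
    have h3 : ∀ w, (u w).toReal * k ‖w - z‖ =
        (closedBall z (η / 2)).indicator (fun w => (u w).toReal) w := fun w => by
      rw [hkn]
      by_cases hw : w ∈ closedBall z (η / 2) <;> simp [hw]
    simp only [h3]
    rw [integral_indicator measurableSet_closedBall, mul_comm, ← smul_eq_mul, ← setIntegral_const]
    refine setIntegral_mono_ae_restrict
      ((hu.locallyIntegrable ⟨z, hz⟩).integrableOn_isCompact (isCompact_closedBall _ _))
      (integrableOn_const measure_closedBall_lt_top.ne) ?_
    filter_upwards [ae_restrict_mem measurableSet_closedBall, ae_restrict_of_ae hae,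
      ae_restrict_of_ae h] with w hw hb huv
    refine EReal.toReal_le_of_le_coe hb (huv.trans (hη' ?_).le)
    exact (mem_closedBall.1 hw).trans_lt (half_lt_self hη)
  rw [hk1, hI] at h1
  have h4 := le_of_mul_le_mul_right (h1.trans h2) hpos
  have h5 : u z ≤ c := by
    rw [← EReal.coe_toReal (hu.lt_top z).ne hz]
    exact_mod_cast h4
  exact absurd hc2 (not_lt.2 h5)

/-! ### Circle averages of test functions -/

theorem laplacian_eq_fderiv_fderiv (φ : ℂ → ℝ) (z : ℂ) :
    Laplacian.laplacian φ z = fderiv ℝ (fderiv ℝ φ) z 1 1 +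
      fderiv ℝ (fderiv ℝ φ) z Complex.I Complex.I := by
  rw [InnerProductSpace.laplacian_eq_iteratedFDeriv_complexPlane]
  simp [iteratedFDeriv_two_apply]

/-- The mean value inequality applied twice, to f' and then to f. The sharp factor 1/2 is dropped,
since only the order r² matters. -/
theorem abs_sub_taylor_two_le {f f' f'' : ℝ → ℝ} (hf : ∀ t, HasDerivAt f (f' t) t)
    (hf' : ∀ t, HasDerivAt f' (f'' t) t) {ε r : ℝ} (hr : 0 ≤ r)
    (h : ∀ t ∈ Icc 0 r, |f'' t - f'' 0| ≤ ε) :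
    |f r - f 0 - r * f' 0 - r ^ 2 / 2 * f'' 0| ≤ ε * r ^ 2 := by
  have h1 : ∀ t ∈ Icc 0 r, ‖f' t - f' 0 - t * f'' 0‖ ≤ ε * r := by
    intro t ht
    have h2 := (convex_Icc (0 : ℝ) r).norm_image_sub_le_of_norm_hasDerivWithin_le
      (f := fun t => f' t - t * f'' 0) (f' := fun t => f'' t - 1 * f'' 0) (C := ε)
      (fun s _ => ((hf' s).sub ((hasDerivAt_id s).mul_const _)).hasDerivWithinAt)
      (fun s hs => by rw [one_mul]; exact h s hs) (left_mem_Icc.2 hr) ht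
    have hε : 0 ≤ ε := (abs_nonneg _).trans (h 0 (left_mem_Icc.2 hr))
    rw [sub_zero, Real.norm_of_nonneg ht.1] at h2
    have h3 : ε * t ≤ ε * r := mul_le_mul_of_nonneg_left ht.2 hε
    refine (le_of_eq ?_).trans (h2.trans h3)
    congr 1; ring
  have h2 := (convex_Icc (0 : ℝ) r).norm_image_sub_le_of_norm_hasDerivWithin_le
    (f := fun t => f t - t * f' 0 - t ^ 2 / 2 * f'' 0)
    (f' := fun t => f' t - 1 * f' 0 - (2 * t ^ (2 - 1) * 1) / 2 * f'' 0) (C := ε * r)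
    (fun s _ => (((hf s).sub ((hasDerivAt_id s).mul_const _)).sub
      ((((hasDerivAt_id s).pow 2).div_const 2).mul_const _)).hasDerivWithinAt)
    (fun s hs => by
      refine (le_of_eq ?_).trans (h1 s hs)
      congr 1; norm_num) (left_mem_Icc.2 hr) (right_mem_Icc.2 hr)
  rw [sub_zero, Real.norm_of_nonneg hr] at h2
  refine (le_of_eq ?_).trans (h2.trans (le_of_eq (by ring)))
  rw [← Real.norm_eq_abs]
  congr 1; ring

/-- The linear and mixed terms integrate to zero, while cos² and sin² have mean 1/2; this is the
source of the factor r²/4 in front of the Laplacian. -/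
theorem integral_quadratic_circle (a : ℝ) (L : ℂ →L[ℝ] ℝ) (B : ℂ →L[ℝ] ℂ →L[ℝ] ℝ) (r : ℝ) :
    ∫ t in (0 : ℝ)..2 * Real.pi, (a + r * L (circleMap 0 1 t) +
      r ^ 2 / 2 * B (circleMap 0 1 t) (circleMap 0 1 t)) =
      2 * Real.pi * (a + r ^ 2 / 4 * (B 1 1 + B Complex.I Complex.I)) := by
  have he : ∀ t : ℝ, circleMap 0 1 t = Real.cos t • (1 : ℂ) + Real.sin t • Complex.I := fun t => by
    simp only [circleMap, Complex.exp_mul_I, Complex.ofReal_one, one_mul, zero_add,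
      Complex.real_smul, mul_one, Complex.ofReal_cos, Complex.ofReal_sin]
  have h1 : ∀ t : ℝ, a + r * L (circleMap 0 1 t) +
      r ^ 2 / 2 * B (circleMap 0 1 t) (circleMap 0 1 t) =
      a + r * L 1 * Real.cos t + r * L Complex.I * Real.sin t +
      r ^ 2 / 2 * B 1 1 * Real.cos t ^ 2 + r ^ 2 / 2 * B Complex.I Complex.I * Real.sin t ^ 2 +
      r ^ 2 / 2 * (B 1 Complex.I + B Complex.I 1) * (Real.sin t * Real.cos t) := fun t => by
    rw [he]
    simp only [map_add, map_smul, add_apply, smul_apply,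
      smul_eq_mul]
    ring
  simp only [h1]
  have hi : ∀ f : ℝ → ℝ, Continuous f → IntervalIntegrable f volume 0 (2 * Real.pi) :=
    fun f hf => hf.intervalIntegrable _ _
  rw [intervalIntegral.integral_add (hi _ (by fun_prop)) (hi _ (by fun_prop)),
    intervalIntegral.integral_add (hi _ (by fun_prop)) (hi _ (by fun_prop)),
    intervalIntegral.integral_add (hi _ (by fun_prop)) (hi _ (by fun_prop)),
    intervalIntegral.integral_add (hi _ (by fun_prop)) (hi _ (by fun_prop)),
    intervalIntegral.integral_add (hi _ (by fun_prop)) (hi _ (by fun_prop))]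
  simp only [intervalIntegral.integral_const_mul, integral_cos, integral_sin, integral_cos_sq,
    integral_sin_sq, integral_sin_mul_cos₁, intervalIntegral.integral_const]
  simp
  ring

theorem exists_norm_sub_lt_of_hasCompactSupport {E F : Type*} [NormedAddCommGroup E]
    [NormedAddCommGroup F] {f : E → F} (hf : Continuous f) (hc : HasCompactSupport f) {ε : ℝ}
    (hε : 0 < ε) : ∃ δ > 0, ∀ a b, ‖a - b‖ < δ → ‖f a - f b‖ < ε := by
  obtain ⟨δ, hδ, hδ'⟩ := Metric.uniformContinuous_iff.1
    (hc.uniformContinuous_of_continuous hf) ε hε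
  refine ⟨δ, hδ, fun a b h => ?_⟩
  rw [← dist_eq_norm]
  exact hδ' (by rwa [dist_eq_norm])

/-- Second-order Taylor expansion along radii; uniform continuity of the compactly supported second
derivative makes the remainder uniform in the centre. -/
theorem exists_abs_circleAverage_sub_le {φ : ℂ → ℝ} (hφ : ContDiff ℝ (⊤ : ℕ∞) φ)
    (hc : HasCompactSupport φ) {ε : ℝ} (hε : 0 < ε) :
    ∃ δ > 0, ∀ r, 0 < r → r < δ → ∀ z,
      |Real.circleAverage φ z r - φ z - r ^ 2 / 4 * Laplacian.laplacian φ z| ≤ ε * r ^ 2 := by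
  have hφ1 : ContDiff ℝ (⊤ : ℕ∞) (fderiv ℝ φ) := hφ.fderiv_right (by simp)
  have hφ2 : ContDiff ℝ (⊤ : ℕ∞) (fderiv ℝ (fderiv ℝ φ)) := hφ1.fderiv_right (by simp)
  obtain ⟨δ, hδ, hδ'⟩ := exists_norm_sub_lt_of_hasCompactSupport hφ2.continuous
    ((hc.fderiv ℝ).fderiv ℝ) hε
  refine ⟨δ, hδ, fun r hr hrδ z => ?_⟩
  have hpt : ∀ t : ℝ, |φ (circleMap z r t) - (φ z + r * fderiv ℝ φ z (circleMap 0 1 t) +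
      r ^ 2 / 2 * fderiv ℝ (fderiv ℝ φ) z (circleMap 0 1 t) (circleMap 0 1 t))| ≤ ε * r ^ 2 := by
    intro t
    set e := circleMap 0 1 t with he
    have hen : ‖e‖ = 1 := by simp [he]
    have hcm : circleMap z r t = z + r • e := by simp [he, circleMap]
    have hline : ∀ s : ℝ, HasDerivAt (fun s : ℝ => z + s • e) e s := fun s => by
      simpa using ((hasDerivAt_id s).smul_const e).const_add z
    have h1 := abs_sub_taylor_two_le (f := fun s => φ (z + s • e))
      (f' := fun s => fderiv ℝ φ (z + s • e) e)
      (f'' := fun s => fderiv ℝ (fderiv ℝ φ) (z + s • e) e e) (r := r) (ε := ε)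
      (fun s => ((hφ.differentiable (by simp)) _).hasFDerivAt.comp_hasDerivAt s (hline s))
      (fun s => by
        have := ((hφ1.differentiable (by simp)) _).hasFDerivAt.comp_hasDerivAt s (hline s)
        exact this.clm_apply (hasDerivAt_const s e) |>.congr_deriv (by simp))
      hr.le (fun s hs => by
        have h2 : ‖(z + s • e) - (z + (0 : ℝ) • e)‖ < δ := by
          simp only [zero_smul, add_zero, add_sub_cancel_left, norm_smul, hen, mul_one,
            Real.norm_of_nonneg hs.1]
          exact hs.2.trans_lt hrδ
        have h3 : ‖fderiv ℝ (fderiv ℝ φ) (z + s • e) - fderiv ℝ (fderiv ℝ φ) (z + (0 : ℝ) • e)‖ ≤ ε :=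
          (hδ' _ _ h2).le
        have h4 := (fderiv ℝ (fderiv ℝ φ) (z + s • e) -
          fderiv ℝ (fderiv ℝ φ) (z + (0 : ℝ) • e)).le_opNorm₂ e e
        rw [hen, mul_one, mul_one, Real.norm_eq_abs] at h4
        exact h4.trans h3)
    simp only [zero_smul, add_zero] at h1
    rw [hcm]
    refine (le_of_eq ?_).trans h1
    congr 1; ring
  have hπ : 0 < 2 * Real.pi := by positivity
  have hcm : Continuous fun t : ℝ => circleMap (0 : ℂ) 1 t := continuous_circleMap 0 1
  have hc1 : Continuous fun t => φ (circleMap z r t) :=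
    hφ.continuous.comp (continuous_circleMap z r)
  have hc2 : Continuous fun t => (φ z + r * fderiv ℝ φ z (circleMap 0 1 t) +
      r ^ 2 / 2 * fderiv ℝ (fderiv ℝ φ) z (circleMap 0 1 t) (circleMap 0 1 t)) := by fun_prop
  have h1 : Real.circleAverage φ z r - φ z - r ^ 2 / 4 * Laplacian.laplacian φ z =
      (2 * Real.pi)⁻¹ * ∫ t in (0 : ℝ)..2 * Real.pi, (φ (circleMap z r t) -
      (φ z + r * fderiv ℝ φ z (circleMap 0 1 t) +
      r ^ 2 / 2 * fderiv ℝ (fderiv ℝ φ) z (circleMap 0 1 t) (circleMap 0 1 t))) := by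
    rw [intervalIntegral.integral_sub (hc1.intervalIntegrable _ _) (hc2.intervalIntegrable _ _),
      integral_quadratic_circle, Real.circleAverage_def, laplacian_eq_fderiv_fderiv, smul_eq_mul]
    field_simp
    ring
  rw [h1, abs_mul, abs_of_pos (inv_pos.2 hπ)]
  have h2 := intervalIntegral.norm_integral_le_of_norm_le_const (a := 0) (b := 2 * Real.pi)
    (f := fun t => φ (circleMap z r t) - (φ z + r * fderiv ℝ φ z (circleMap 0 1 t) +
      r ^ 2 / 2 * fderiv ℝ (fderiv ℝ φ) z (circleMap 0 1 t) (circleMap 0 1 t))) (fun t _ => hpt t)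
  rw [Real.norm_eq_abs, sub_zero, abs_of_pos hπ] at h2
  rw [inv_mul_le_iff₀ hπ]
  linarith

/-! ### Positivity of the distributional Laplacian -/

/-- Circle averaging is symmetric: Tonelli, then translation by r e^{it}, which moves the average to
φ with radius -r, and circle averages do not depend on the sign of the radius. -/
theorem lintegral_mul_lintegral_circleMap {φ : ℂ → ℝ} (hφ : Continuous φ) (h0 : ∀ z, 0 ≤ φ z)
    {N : ℂ → ENNReal} (hN : Measurable N) (r : ℝ) :
    ∫⁻ z, ENNReal.ofReal (φ z) * ∫⁻ t in Ioc 0 (2 * Real.pi), N (circleMap z r t) =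
      ENNReal.ofReal (2 * Real.pi) * ∫⁻ z, ENNReal.ofReal (Real.circleAverage φ z r) * N z := by
  have hφm : Measurable fun z => ENNReal.ofReal (φ z) := hφ.measurable.ennreal_ofReal
  have hcm : Continuous fun p : ℂ × ℝ => circleMap p.1 r p.2 := by
    simp only [circleMap]; fun_prop
  have hcm' : Continuous fun p : ℂ × ℝ => circleMap p.1 (-r) p.2 := by
    simp only [circleMap]; fun_prop
  have hNm : ∀ z, Measurable fun t => N (circleMap z r t) := fun z =>
    hN.comp (continuous_circleMap z r).measurable
  calc ∫⁻ z, ENNReal.ofReal (φ z) * ∫⁻ t in Ioc 0 (2 * Real.pi), N (circleMap z r t)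
      = ∫⁻ z, ∫⁻ t in Ioc 0 (2 * Real.pi), ENNReal.ofReal (φ z) * N (circleMap z r t) :=
        lintegral_congr fun z => (lintegral_const_mul _ (hNm z)).symm
    _ = ∫⁻ t in Ioc 0 (2 * Real.pi), ∫⁻ z, ENNReal.ofReal (φ z) * N (circleMap z r t) := by
        refine lintegral_lintegral_swap (Measurable.aemeasurable ?_)
        exact (hφm.comp measurable_fst).mul (hN.comp hcm.measurable)
    _ = ∫⁻ t in Ioc 0 (2 * Real.pi), ∫⁻ z, ENNReal.ofReal (φ (circleMap z (-r) t)) * N z := by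
        refine lintegral_congr fun t => ?_
        rw [← lintegral_add_right_eq_self
          (fun z => ENNReal.ofReal (φ (circleMap z (-r) t)) * N z) (circleMap 0 r t)]
        refine lintegral_congr fun z => ?_
        congr 3
        · simp [circleMap]
        · simp [circleMap]
    _ = ∫⁻ z, ∫⁻ t in Ioc 0 (2 * Real.pi), ENNReal.ofReal (φ (circleMap z (-r) t)) * N z := by
        refine lintegral_lintegral_swap (Measurable.aemeasurable ?_)
        exact ((hφm.comp hcm'.measurable).comp measurable_swap).mul (hN.comp measurable_snd)
    _ = ∫⁻ z, ENNReal.ofReal (2 * Real.pi) *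
          (ENNReal.ofReal (Real.circleAverage φ z r) * N z) := by
        refine lintegral_congr fun z => ?_
        have hc1 : Continuous fun t => φ (circleMap z (-r) t) :=
          hφ.comp (continuous_circleMap z (-r))
        rw [lintegral_mul_const _ hc1.measurable.ennreal_ofReal, ← mul_assoc,
          ← ofReal_integral_eq_lintegral_ofReal hc1.integrableOn_Ioc (ae_of_all _ fun t => h0 _),
          ← ENNReal.ofReal_mul (by positivity), ← Real.circleAverage_neg_radius,
          Real.circleAverage_def, intervalIntegral.integral_of_le (by positivity), smul_eq_mul,
          mul_inv_cancel_left₀ (by positivity)]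
    _ = _ := lintegral_const_mul' _ _ ENNReal.ofReal_ne_top

theorem continuous_circleAverage_center {φ : ℂ → ℝ} (hφ : Continuous φ) (r : ℝ) :
    Continuous fun z => Real.circleAverage φ z r := by
  simp only [Real.circleAverage_def]
  refine Continuous.const_smul (M := ℝ) ?_ (2 * Real.pi)⁻¹
  refine intervalIntegral.continuous_parametric_intervalIntegral_of_continuous' ?_ _ _
  refine hφ.comp ?_
  simp only [circleMap]
  fun_prop

theorem circleAverage_eq_zero_of_notMem {φ : ℂ → ℝ} {R r : ℝ} (hr : 0 ≤ r)
    (hφ : ∀ z ∉ closedBall (0 : ℂ) R, φ z = 0) {z : ℂ} (hz : z ∉ closedBall (0 : ℂ) (R + r)) :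
    Real.circleAverage φ z r = 0 := by
  refine Real.circleAverage_const_on_circle (fun w hw => hφ w fun hw' => hz ?_)
  rw [abs_of_nonneg hr, mem_sphere] at hw
  rw [mem_closedBall] at hw' ⊢
  have := dist_triangle z w 0
  rw [dist_comm z w] at this
  linarith

theorem IsSubharmonic.integrable_mul {u : ℂ → EReal} (hu : IsSubharmonic u) (hne : ∃ z, u z ≠ ⊥)
    {ψ : ℂ → ℝ} (hψ : Continuous ψ) (hc : HasCompactSupport ψ) :
    Integrable fun z => (u z).toReal * ψ z := by
  simpa [smul_eq_mul] using
    (hu.locallyIntegrable hne).integrable_smul_right_of_hasCompactSupport hψ hc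

/-- Passes between the `ENNReal` integrals of C - u, where Tonelli needs no integrability check, and
the real integrals of u. -/
theorem IsSubharmonic.lintegral_ofReal_mul {u : ℂ → EReal} (hu : IsSubharmonic u)
    (hne : ∃ z, u z ≠ ⊥) {S : Set ℂ} (hS : IsCompact S) {C : ℝ} (hC : ∀ w ∈ S, u w ≤ C) {ψ : ℂ → ℝ}
    (hψ : Continuous ψ) (h0 : ∀ z, 0 ≤ ψ z) (hψS : ∀ z ∉ S, ψ z = 0) :
    ∫⁻ z, ENNReal.ofReal (ψ z) * ((C : EReal) - u z).toENNReal =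
      ENNReal.ofReal (C * (∫ z, ψ z) - ∫ z, (u z).toReal * ψ z) ∧
    0 ≤ C * (∫ z, ψ z) - ∫ z, (u z).toReal * ψ z := by
  have hc : HasCompactSupport ψ := HasCompactSupport.intro hS hψS
  have h1 := hu.integrable_mul hne hψ hc
  have h2 : Integrable fun z => C * ψ z := (hψ.integrable_of_hasCompactSupport hc).const_mul C
  have h3 : Integrable fun z => C * ψ z - (u z).toReal * ψ z := h2.sub h1
  have h4 : 0 ≤ᵐ[volume] fun z => C * ψ z - (u z).toReal * ψ z := by
    filter_upwards [hu.ae_ne_bot hne] with z hz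
    by_cases hzS : z ∈ S
    · rw [← sub_mul]
      exact mul_nonneg (sub_nonneg.2 (EReal.toReal_le_of_le_coe hz (hC z hzS))) (h0 z)
    · simp [hψS z hzS]
  have h5 : C * (∫ z, ψ z) - ∫ z, (u z).toReal * ψ z = ∫ z, (C * ψ z - (u z).toReal * ψ z) := by
    rw [integral_sub h2 h1, integral_const_mul]
  rw [h5]
  refine ⟨?_, integral_nonneg_of_ae h4⟩
  rw [ofReal_integral_eq_lintegral_ofReal h3 h4]
  refine lintegral_congr_ae ?_
  filter_upwards [hu.ae_ne_bot hne] with z hz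
  rw [EReal.toENNReal_coe_sub hz (hu.lt_top z).ne, ← ENNReal.ofReal_mul (h0 _)]
  congr 1; ring

theorem integral_circleAverage {φ : ℂ → ℝ} (hφ : Continuous φ) (h0 : ∀ z, 0 ≤ φ z) (r : ℝ) :
    ∫ z, Real.circleAverage φ z r = ∫ z, φ z := by
  have hA0 : ∀ z, 0 ≤ Real.circleAverage φ z r := fun z =>
    Real.circleAverage_nonneg_of_nonneg fun w _ => h0 w
  have h1 := lintegral_mul_lintegral_circleMap hφ h0 (N := 1) measurable_one r
  simp only [Pi.one_apply, lintegral_const, one_mul, mul_one, Measure.restrict_apply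
    MeasurableSet.univ, univ_inter, Real.volume_Ioc, sub_zero] at h1
  rw [lintegral_mul_const _ hφ.measurable.ennreal_ofReal, mul_comm] at h1
  rw [ENNReal.mul_right_inj (by simp [Real.pi_pos]) ENNReal.ofReal_ne_top] at h1
  rw [integral_eq_lintegral_of_nonneg_ae (ae_of_all _ h0) hφ.aestronglyMeasurable,
    integral_eq_lintegral_of_nonneg_ae (ae_of_all _ hA0)
    (continuous_circleAverage_center hφ r).aestronglyMeasurable, h1]

/-- The submean inequality integrated against φ, with the averaging moved onto φ by symmetry. The
argument runs with C - u ≥ 0; the terms with C cancel because averaging preserves the integral of φ.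
-/
theorem IsSubharmonic.integral_mul_circleAverage_ge {u : ℂ → EReal} (hu : IsSubharmonic u)
    (hne : ∃ z, u z ≠ ⊥) {φ : ℂ → ℝ} (hφ : Continuous φ) (hc : HasCompactSupport φ)
    (h0 : ∀ z, 0 ≤ φ z) {r : ℝ} (hr : 0 < r) :
    ∫ z, (u z).toReal * φ z ≤ ∫ z, (u z).toReal * Real.circleAverage φ z r := by
  obtain ⟨R, hR⟩ := hc.isCompact.isBounded.subset_closedBall (0 : ℂ)
  have hφR : ∀ z ∉ closedBall (0 : ℂ) R, φ z = 0 := fun z hz =>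
    image_eq_zero_of_notMem_tsupport fun h => hz (hR h)
  obtain ⟨C, hC⟩ := hu.exists_le_coe (isCompact_closedBall (0 : ℂ) (R + r))
  have hA0 : ∀ z, 0 ≤ Real.circleAverage φ z r := fun z =>
    Real.circleAverage_nonneg_of_nonneg fun w _ => h0 w
  have h1 : ∫⁻ z, ENNReal.ofReal (φ z) * ∫⁻ t in Ioc 0 (2 * Real.pi),
      ((C : EReal) - u (circleMap z r t)).toENNReal ≤
      ∫⁻ z, ENNReal.ofReal (2 * Real.pi) *
        (ENNReal.ofReal (φ z) * ((C : EReal) - u z).toENNReal) := by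
    refine lintegral_mono fun z => ?_
    by_cases hz : z ∈ closedBall (0 : ℂ) R
    · rw [← mul_assoc, mul_comm (ENNReal.ofReal (2 * Real.pi)), mul_assoc]
      refine mul_le_mul_right (hu.lintegral_circle_le hr fun w hw => hC w ?_) _
      rw [mem_closedBall] at hz ⊢
      rw [mem_sphere] at hw
      linarith [dist_triangle w z 0]
    · simp [hφR z hz]
  rw [lintegral_mul_lintegral_circleMap hφ h0 (hu.measurable_toENNReal C),
    lintegral_const_mul' _ _ ENNReal.ofReal_ne_top,
    ENNReal.mul_le_mul_iff_right (by simp [Real.pi_pos]) ENNReal.ofReal_ne_top] at h1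
  obtain ⟨h2, h2'⟩ := hu.lintegral_ofReal_mul hne (isCompact_closedBall _ _) hC hφ h0
    (fun z hz => hφR z fun h => hz (closedBall_subset_closedBall (by linarith) h))
  obtain ⟨h3, -⟩ := hu.lintegral_ofReal_mul hne (isCompact_closedBall _ _) hC
    (continuous_circleAverage_center hφ r) hA0
    (fun z hz => circleAverage_eq_zero_of_notMem hr.le hφR hz)
  rw [h2, h3, ENNReal.ofReal_le_ofReal_iff h2', integral_circleAverage hφ h0 r] at h1
  linarith

theorem HasCompactSupport.laplacian {φ : ℂ → ℝ} (hc : HasCompactSupport φ) :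
    HasCompactSupport (Laplacian.laplacian φ) := by
  refine HasCompactSupport.intro hc.isCompact fun z hz => ?_
  have : φ =ᶠ[𝓝 z] fun _ => 0 := notMem_tsupport_iff_eventuallyEq.1 hz
  rw [(InnerProductSpace.laplacian_congr_nhds this).eq_of_nhds]
  simp

theorem ContDiff.continuous_laplacian {φ : ℂ → ℝ} (hφ : ContDiff ℝ (⊤ : ℕ∞) φ) :
    Continuous (Laplacian.laplacian φ) := by
  have hφ1 : ContDiff ℝ (⊤ : ℕ∞) (fderiv ℝ φ) := hφ.fderiv_right (by simp)
  have hφ2 : ContDiff ℝ (⊤ : ℕ∞) (fderiv ℝ (fderiv ℝ φ)) := hφ1.fderiv_right (by simp)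
  have := hφ2.continuous
  rw [show Laplacian.laplacian φ = _ from funext (laplacian_eq_fderiv_fderiv φ)]
  fun_prop

/-- The distributional Laplacian of a subharmonic function is positive. -/
theorem IsSubharmonic.integral_mul_laplacian_nonneg {u : ℂ → EReal} (hu : IsSubharmonic u)
    (hne : ∃ z, u z ≠ ⊥) {φ : ℂ → ℝ} (hφ : ContDiff ℝ (⊤ : ℕ∞) φ) (hc : HasCompactSupport φ)
    (h0 : ∀ z, 0 ≤ φ z) : 0 ≤ ∫ z, (u z).toReal * Laplacian.laplacian φ z := by
  obtain ⟨R, hR⟩ := hc.isCompact.isBounded.subset_closedBall (0 : ℂ)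
  have hφR : ∀ z ∉ closedBall (0 : ℂ) R, φ z = 0 := fun z hz =>
    image_eq_zero_of_notMem_tsupport fun h => hz (hR h)
  have hφR1 : ∀ z ∉ closedBall (0 : ℂ) (R + 1), φ z = 0 := fun z hz =>
    hφR z fun h => hz (closedBall_subset_closedBall (by linarith) h)
  set A := ∫ z in closedBall (0 : ℂ) (R + 1), |(u z).toReal| with hA
  have hA0 : 0 ≤ A := integral_nonneg fun z => abs_nonneg _
  -- The integral of u times (average of φ minus φ) is nonnegative and differs from r²/4 times the
  -- wanted integral by at most εr²A; divide by r²/4. Taking r ≤ 1 keeps all supports in one disc.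
  have key : ∀ ε : ℝ, 0 < ε → -(4 * ε * A) ≤ ∫ z, (u z).toReal * Laplacian.laplacian φ z := by
    intro ε hε
    obtain ⟨δ, hδ, hδ'⟩ := exists_abs_circleAverage_sub_le hφ hc hε
    obtain ⟨r, hr0, hr⟩ := exists_between (lt_min hδ one_pos)
    have hr1 : r ≤ 1 := (hr.trans_le (min_le_right _ _)).le
    have h1 := hu.integral_mul_circleAverage_ge hne hφ.continuous hc h0 hr0
    have hAR : ∀ z ∉ closedBall (0 : ℂ) (R + 1), Real.circleAverage φ z r = 0 := fun z hz =>
      circleAverage_eq_zero_of_notMem hr0.le hφR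
        fun h => hz (closedBall_subset_closedBall (by linarith) h)
    have hi1 := hu.integrable_mul hne hφ.continuous hc
    have hi2 := hu.integrable_mul hne (continuous_circleAverage_center hφ.continuous r)
      (HasCompactSupport.intro (isCompact_closedBall _ _) hAR)
    have hi3 := hu.integrable_mul hne hφ.continuous_laplacian hc.laplacian
    have hL : ∀ z ∉ closedBall (0 : ℂ) (R + 1), Laplacian.laplacian φ z = 0 := fun z hz => by
      have hz' : z ∉ tsupport φ := fun h =>
        hz (closedBall_subset_closedBall (by linarith) (hR h))
      rw [(InnerProductSpace.laplacian_congr_nhds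
        (notMem_tsupport_iff_eventuallyEq.1 hz')).eq_of_nhds]
      exact congrFun InnerProductSpace.laplacian_const z
    have hi4 : Integrable fun z => (u z).toReal * Real.circleAverage φ z r - (u z).toReal * φ z -
        r ^ 2 / 4 * ((u z).toReal * Laplacian.laplacian φ z) :=
      (hi2.sub hi1).sub (hi3.const_mul (r ^ 2 / 4))
    have hi5 : IntegrableOn (fun z => |(u z).toReal|) (closedBall (0 : ℂ) (R + 1)) :=
      ((hu.locallyIntegrable hne).integrableOn_isCompact (isCompact_closedBall _ _)).abs
    have h2 : ∫ z, ((u z).toReal * Real.circleAverage φ z r - (u z).toReal * φ z -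
        r ^ 2 / 4 * ((u z).toReal * Laplacian.laplacian φ z)) ≤ ε * r ^ 2 * A := by
      rw [hA, ← integral_const_mul, ← integral_indicator measurableSet_closedBall]
      refine integral_mono hi4 (IntegrableOn.integrable_indicator (hi5.const_mul _) measurableSet_closedBall)
        fun z => ?_
      by_cases hz : z ∈ closedBall (0 : ℂ) (R + 1)
      · rw [indicator_of_mem hz]
        have h3 := hδ' r hr0 (hr.trans_le (min_le_left _ _)) z
        calc (u z).toReal * Real.circleAverage φ z r - (u z).toReal * φ z -
              r ^ 2 / 4 * ((u z).toReal * Laplacian.laplacian φ z)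
            = (u z).toReal * (Real.circleAverage φ z r - φ z -
              r ^ 2 / 4 * Laplacian.laplacian φ z) := by ring
          _ ≤ |(u z).toReal| * |Real.circleAverage φ z r - φ z -
              r ^ 2 / 4 * Laplacian.laplacian φ z| := by
            rw [← abs_mul]; exact le_abs_self _
          _ ≤ |(u z).toReal| * (ε * r ^ 2) := mul_le_mul_of_nonneg_left h3 (abs_nonneg _)
          _ = ε * r ^ 2 * |(u z).toReal| := by ring
      · rw [indicator_of_notMem hz]
        simp [hAR z hz, hφR1 z hz, hL z hz]
    have hi21 : Integrable fun z =>
      (u z).toReal * Real.circleAverage φ z r - (u z).toReal * φ z := hi2.sub hi1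
    rw [integral_sub hi21 (hi3.const_mul _), integral_sub hi2 hi1, integral_const_mul] at h2
    have h4 : -(r ^ 2 / 4 * ∫ z, (u z).toReal * Laplacian.laplacian φ z) ≤ ε * r ^ 2 * A := by
      linarith
    have hr2 : 0 < r ^ 2 := by positivity
    nlinarith
  refine le_of_forall_pos_le_add fun ε hε => ?_
  -- A + 1 instead of A avoids dividing by zero.
  have h1 := key (ε / (4 * (A + 1))) (by positivity)
  have h2 : 4 * (ε / (4 * (A + 1))) * A ≤ ε := by
    rw [show 4 * (ε / (4 * (A + 1))) * A = ε * A / (A + 1) by field_simp, div_le_iff₀ (by positivity)]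
    nlinarith
  linarith

/-! ### The Laplacian as a measure -/

/-- Smooth Urysohn lemma in the plane, with compact support. -/
theorem exists_contDiff_cutoff {S V : Set ℂ} (hS : IsCompact S) (hV : IsOpen V) (hSV : S ⊆ V) :
    ∃ χ : ℂ → ℝ, ContDiff ℝ (⊤ : ℕ∞) χ ∧ HasCompactSupport χ ∧ (∀ z ∈ S, χ =ᶠ[𝓝 z] fun _ => 1) ∧
      (∀ z ∉ V, χ z = 0) ∧ ∀ z, 0 ≤ χ z ∧ χ z ≤ 1 := by
  obtain ⟨T, hT, hST, hTV⟩ := exists_compact_between hS hV hSV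
  obtain ⟨f, hf1, hf0, hf⟩ := exists_contMDiffMap_one_nhds_of_subset_interior
    (modelWithCornersSelf ℝ ℂ) (n := (⊤ : ℕ∞)) hS.isClosed hST
  refine ⟨f, f.contMDiff.contDiff, HasCompactSupport.intro hT hf0, fun z hz => ?_,
    fun z hz => hf0 z fun h => hz (hTV h), hf⟩
  exact hf1.filter_mono (nhds_le_nhdsSet hz)

theorem two_le_coe_top : (2 : WithTop ℕ∞) ≤ ((⊤ : ℕ∞) : WithTop ℕ∞) := by
  exact WithTop.coe_le_coe.2 (le_top : (2 : ℕ∞) ≤ ⊤)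

theorem laplacian_add_of_contDiff {φ ψ : ℂ → ℝ} (hφ : ContDiff ℝ (⊤ : ℕ∞) φ)
    (hψ : ContDiff ℝ (⊤ : ℕ∞) ψ) (z : ℂ) : Laplacian.laplacian (φ + ψ) z =
      Laplacian.laplacian φ z + Laplacian.laplacian ψ z :=
  (hφ.of_le two_le_coe_top).contDiffAt.laplacian_add
    (hψ.of_le two_le_coe_top).contDiffAt

theorem laplacian_smul_of_contDiff {φ : ℂ → ℝ} (hφ : ContDiff ℝ (⊤ : ℕ∞) φ) (c : ℝ) (z : ℂ) :
    Laplacian.laplacian (c • φ) z = c * Laplacian.laplacian φ z :=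
  InnerProductSpace.laplacian_smul c (hφ.of_le two_le_coe_top).contDiffAt

/-- A positive functional on smooth test functions extends to a positive functional on `C_c(ℂ, ℝ)`
by M. Riesz's extension theorem, and the Riesz–Markov–Kakutani theorem represents the extension by a
measure. -/
theorem IsSubharmonic.exists_isLaplacian {u : ℂ → EReal} (hu : IsSubharmonic u)
    (hne : ∃ z, u z ≠ ⊥) : ∃ μ : Measure ℂ, IsLaplacian u μ := by
  let D : Submodule ℝ C_c(ℂ, ℝ) :=
    { carrier := {f | ContDiff ℝ (⊤ : ℕ∞) f}
      add_mem' := fun {f g} hf hg => by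
        exact (show ContDiff ℝ (⊤ : ℕ∞) (f : ℂ → ℝ) from hf).add
          (show ContDiff ℝ (⊤ : ℕ∞) (g : ℂ → ℝ) from hg)
      zero_mem' := by
        exact (contDiff_const (c := (0 : ℝ)) : ContDiff ℝ (⊤ : ℕ∞) fun _ : ℂ => (0 : ℝ))
      smul_mem' := fun c f hf => by
        exact (show ContDiff ℝ (⊤ : ℕ∞) (f : ℂ → ℝ) from hf).const_smul c }
  have hI : ∀ f : D, Integrable fun z => (u z).toReal * Laplacian.laplacian (f.1 : ℂ → ℝ) z := fun f =>
    hu.integrable_mul hne (ContDiff.continuous_laplacian f.2) f.1.hasCompactSupport.laplacian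
  let L : C_c(ℂ, ℝ) →ₗ.[ℝ] ℝ :=
    { domain := D
      toFun :=
        { toFun := fun f => ∫ z, (u z).toReal * Laplacian.laplacian (f.1 : ℂ → ℝ) z
          map_add' := fun f g => by
            rw [← integral_add (hI f) (hI g)]
            refine integral_congr_ae (ae_of_all _ fun z => ?_)
            show (u z).toReal * Laplacian.laplacian ((f.1 : ℂ → ℝ) + (g.1 : ℂ → ℝ)) z = _
            rw [laplacian_add_of_contDiff f.2 g.2, mul_add]
          map_smul' := fun c f => by
            rw [RingHom.id_apply, smul_eq_mul, ← integral_const_mul]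
            refine integral_congr_ae (ae_of_all _ fun z => ?_)
            show (u z).toReal * Laplacian.laplacian (c • (f.1 : ℂ → ℝ)) z = _
            rw [laplacian_smul_of_contDiff f.2]
            ring } }
  let P : PointedCone ℝ C_c(ℂ, ℝ) :=
    { carrier := {f | ∀ z, 0 ≤ f z}
      add_mem' := fun {f g} hf hg z => add_nonneg (hf z) (hg z)
      zero_mem' := fun z => le_rfl
      smul_mem' := fun c f hf z => mul_nonneg c.2 (hf z) }
  obtain ⟨Λ, hΛL, hΛ⟩ := riesz_extension P L
    (fun f hf => hu.integral_mul_laplacian_nonneg hne f.2 f.1.hasCompactSupport hf)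
    (fun f => by
      -- Cofinality for the extension theorem: with |f| ≤ M and χ = 1 on the support of f, the
      -- smooth function Mχ satisfies Mχ + f ≥ 0.
      obtain ⟨χ, hχ, hχc, hχ1, -, hχ0⟩ := exists_contDiff_cutoff f.hasCompactSupport.isCompact
        isOpen_univ (subset_univ _)
      obtain ⟨M, hM⟩ := f.hasCompactSupport.exists_bound_of_continuous f.continuous
      refine ⟨⟨⟨⟨fun z => M * χ z, continuous_const.mul hχ.continuous⟩, hχc.mul_left⟩,
        contDiff_const.mul hχ⟩, fun z => ?_⟩
      show 0 ≤ M * χ z + f z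
      have h1 := hM z
      have hM0 : 0 ≤ M := (norm_nonneg _).trans h1
      rw [Real.norm_eq_abs] at h1
      by_cases hz : z ∈ tsupport f
      · rw [(hχ1 z hz).eq_of_nhds]
        linarith [neg_abs_le (f z)]
      · rw [image_eq_zero_of_notMem_tsupport hz]
        have := mul_nonneg hM0 (hχ0 z).1
        linarith)
  let Λ' : C_c(ℂ, ℝ) →ₚ[ℝ] ℝ := PositiveLinearMap.mk₀ Λ fun f hf => hΛ f hf
  refine ⟨RealRMK.rieszMeasure Λ', fun C hC => hC.measure_lt_top, fun φ hφ hc => ?_⟩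
  have h1 := RealRMK.integral_rieszMeasure Λ' ⟨⟨φ, hφ.continuous⟩, hc⟩
  have h2 := hΛL ⟨⟨⟨φ, hφ.continuous⟩, hc⟩, hφ⟩
  exact h1.trans h2

theorem IsSubharmonic.isLaplacian_laplacianMeasure {u : ℂ → EReal} (hu : IsSubharmonic u)
    (hne : ∃ z, u z ≠ ⊥) : IsLaplacian u (laplacianMeasure u) := by
  have h := hu.exists_isLaplacian hne
  rw [laplacianMeasure, dif_pos h]
  exact h.choose_spec

/-! ### The truncated logarithmic kernel and its Laplacian -/

/-- A smooth function equal to `1` on `(-∞, -1]` and to `0` on `[0, ∞)`. -/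
noncomputable def stepDown (x : ℝ) : ℝ := Real.smoothTransition (-x)

/-- The primitive of `stepDown` that vanishes on `[0, ∞)`. -/
noncomputable def truncId (x : ℝ) : ℝ := ∫ t in (0 : ℝ)..x, stepDown t

theorem contDiff_stepDown : ContDiff ℝ (⊤ : ℕ∞) stepDown :=
  Real.smoothTransition.contDiff.comp contDiff_neg

theorem stepDown_nonneg (x : ℝ) : 0 ≤ stepDown x := Real.smoothTransition.nonneg _

theorem stepDown_le_one (x : ℝ) : stepDown x ≤ 1 := Real.smoothTransition.le_one _

theorem stepDown_of_nonneg {x : ℝ} (hx : 0 ≤ x) : stepDown x = 0 :=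
  Real.smoothTransition.zero_of_nonpos (by linarith)

theorem stepDown_of_le {x : ℝ} (hx : x ≤ -1) : stepDown x = 1 :=
  Real.smoothTransition.one_of_one_le (by linarith)

theorem deriv_stepDown_of_lt {x : ℝ} (hx : x < -1) : deriv stepDown x = 0 := by
  have : stepDown =ᶠ[𝓝 x] fun _ => 1 :=
    (eventually_lt_nhds hx).mono fun y hy => stepDown_of_le hy.le
  rw [this.deriv_eq, deriv_const]

theorem deriv_stepDown_of_nonneg {x : ℝ} (hx : 0 ≤ x) : deriv stepDown x = 0 := by
  have hd : DifferentiableAt ℝ stepDown x := (contDiff_stepDown.differentiable (by simp)) x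
  have h1 : HasDerivWithinAt stepDown 0 (Ici x) x :=
    (hasDerivWithinAt_const x (Ici x) (0 : ℝ)).congr
      (fun y hy => stepDown_of_nonneg (hx.trans hy)) (stepDown_of_nonneg hx)
  exact (uniqueDiffWithinAt_Ici x).eq_deriv _ hd.hasDerivAt.hasDerivWithinAt h1

theorem hasDerivAt_truncId (x : ℝ) : HasDerivAt truncId (stepDown x) x :=
  contDiff_stepDown.continuous.integral_hasStrictDerivAt 0 x |>.hasDerivAt

theorem contDiff_truncId : ContDiff ℝ (⊤ : ℕ∞) truncId := by
  rw [contDiff_infty_iff_deriv]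
  refine ⟨fun x => (hasDerivAt_truncId x).differentiableAt, ?_⟩
  rw [funext fun x => (hasDerivAt_truncId x).deriv]
  exact contDiff_stepDown

theorem truncId_of_nonneg {x : ℝ} (hx : 0 ≤ x) : truncId x = 0 := by
  rw [truncId, intervalIntegral.integral_congr (g := fun _ => 0) fun t ht => ?_]
  · simp
  · rw [uIcc_of_le hx] at ht
    exact stepDown_of_nonneg ht.1

theorem truncId_sub_nonneg {x y : ℝ} (h : x ≤ y) : 0 ≤ truncId y - truncId x := by
  rw [truncId, truncId, intervalIntegral.integral_interval_sub_left
    (contDiff_stepDown.continuous.intervalIntegrable _ _)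
    (contDiff_stepDown.continuous.intervalIntegrable _ _)]
  exact intervalIntegral.integral_nonneg h fun t _ => stepDown_nonneg t

theorem truncId_mono : Monotone truncId := fun _ _ h => sub_nonneg.1 (truncId_sub_nonneg h)

theorem truncId_sub_le {x y : ℝ} (h : x ≤ y) : truncId y - truncId x ≤ y - x := by
  rw [truncId, truncId, intervalIntegral.integral_interval_sub_left
    (contDiff_stepDown.continuous.intervalIntegrable _ _)
    (contDiff_stepDown.continuous.intervalIntegrable _ _)]
  have := intervalIntegral.integral_mono_on (μ := volume) h
    (contDiff_stepDown.continuous.intervalIntegrable x y)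
    ((continuous_const : Continuous fun _ : ℝ => (1 : ℝ)).intervalIntegrable x y) fun t _ => stepDown_le_one t
  simpa using this

theorem truncId_nonpos (x : ℝ) : truncId x ≤ 0 := by
  rw [← truncId_of_nonneg (le_max_right x 0)]
  exact truncId_mono (le_max_left x 0)

theorem truncId_le (x : ℝ) : truncId x ≤ x + 1 := by
  rcases le_total (-1) x with h | h
  · linarith [truncId_nonpos x]
  · have h1 : ∫ t in x..(-1), stepDown t = -1 - x := by
      rw [intervalIntegral.integral_congr (g := fun _ => 1) fun t ht => ?_]
      · simp
      · rw [uIcc_of_le h] at ht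
        exact stepDown_of_le ht.2
    have h2 := intervalIntegral.integral_interval_sub_left (f := stepDown) (μ := volume)
      (contDiff_stepDown.continuous.intervalIntegrable 0 (-1))
      (contDiff_stepDown.continuous.intervalIntegrable 0 x)
    have h3 : truncId (-1) - truncId x = -1 - x := h2.trans h1
    linarith [truncId_nonpos (-1)]

/-- The regularised and truncated logarithmic kernel. -/
noncomputable def logKernel (ε : ℝ) (w : ℂ) : ℝ := truncId (Real.log (‖w‖ ^ 2 + ε ^ 2))

/-- The concentrated part of the Laplacian of `logKernel`, as a function of the radius. -/
noncomputable def innerKernel (ε r : ℝ) : ℝ :=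
  stepDown (Real.log (r ^ 2 + ε ^ 2)) * (4 * ε ^ 2 / (r ^ 2 + ε ^ 2) ^ 2)

/-- The part of the Laplacian of `logKernel` that comes from the truncation. -/
noncomputable def outerKernel (ε : ℝ) (w : ℂ) : ℝ :=
  4 * ‖w‖ ^ 2 * (deriv stepDown (Real.log (‖w‖ ^ 2 + ε ^ 2)) / (‖w‖ ^ 2 + ε ^ 2) ^ 2)

theorem logKernel_nonpos (ε : ℝ) (w : ℂ) : logKernel ε w ≤ 0 := truncId_nonpos _

theorem logKernel_eq_zero {ε : ℝ} {w : ℂ} (hw : 1 ≤ ‖w‖) : logKernel ε w = 0 :=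
  truncId_of_nonneg (Real.log_nonneg (by nlinarith [sq_nonneg ε]))

theorem contDiff_logKernel {ε : ℝ} (hε : 0 < ε) : ContDiff ℝ (⊤ : ℕ∞) (logKernel ε) := by
  refine contDiff_truncId.comp (ContDiff.log ?_ fun w => ?_)
  · exact (contDiff_norm_sq ℝ).add contDiff_const
  · positivity

/-- Chain rule in the variable s = |w - z|², whose gradient is 2(w - z) and whose Laplacian is 4.
Working with s rather than |w - z| avoids the singularity at the centre. -/
theorem laplacian_radial {F F' F'' : ℝ → ℝ} (hF : ∀ s, 0 ≤ s → HasDerivAt F (F' s) s)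
    (hF' : ∀ s, 0 ≤ s → HasDerivAt F' (F'' s) s) (z w : ℂ) :
    Laplacian.laplacian (fun w => F (‖w - z‖ ^ 2)) w =
      4 * F' (‖w - z‖ ^ 2) + 4 * ‖w - z‖ ^ 2 * F'' (‖w - z‖ ^ 2) := by
  have hn : ∀ w : ℂ, HasFDerivAt (fun w => ‖w - z‖ ^ 2) (2 • innerSL ℝ (w - z)) w := fun w => by
    have := ((hasFDerivAt_id (𝕜 := ℝ) w).sub_const z).norm_sq
    simpa using this
  have h1 : fderiv ℝ (fun w => F (‖w - z‖ ^ 2)) =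
      fun w => F' (‖w - z‖ ^ 2) • (2 • innerSL ℝ (w - z)) := funext fun w =>
    ((hF _ (by positivity)).comp_hasFDerivAt w (hn w)).fderiv
  have h2 : HasFDerivAt (fun w : ℂ => (2 • innerSL ℝ (w - z) : ℂ →L[ℝ] ℝ))
      (2 • (innerSL ℝ : ℂ →L[ℝ] ℂ →L[ℝ] ℝ)) w := by
    have h3 := ((innerSL ℝ : ℂ →L[ℝ] ℂ →L[ℝ] ℝ).hasFDerivAt (x := w - z)).comp w
      ((hasFDerivAt_id (𝕜 := ℝ) w).sub_const z)
    exact (h3.const_smul 2)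
  have h3 := ((hF' (‖w - z‖ ^ 2) (by positivity)).comp_hasFDerivAt w (hn w)).smul h2
  have h4 : fderiv ℝ (fun w => F' (‖w - z‖ ^ 2) • (2 • innerSL ℝ (w - z) : ℂ →L[ℝ] ℝ)) w = _ :=
    h3.fderiv
  rw [laplacian_eq_fderiv_fderiv, h1, h4]
  have hns : ‖w - z‖ ^ 2 = (w - z).re * (w - z).re + (w - z).im * (w - z).im := by
    rw [← Complex.normSq_eq_norm_sq, Complex.normSq_apply]
  have e1 : (innerSL ℝ (1 : ℂ)) 1 = (1 : ℝ) := by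
    rw [innerSL_apply_apply, real_inner_self_eq_norm_sq]; simp
  have e2 : (innerSL ℝ Complex.I) Complex.I = (1 : ℝ) := by
    rw [innerSL_apply_apply, real_inner_self_eq_norm_sq]; simp
  simp [Complex.inner, e1, e2]
  rw [Complex.sub_re, Complex.sub_im] at hns
  linear_combination (-4 * F'' (‖w - z‖ ^ 2)) * hns

/-- The terms containing `stepDown` combine through 4/(s + ε²) - 4s/(s + ε²)² = 4ε²/(s + ε²)², an
approximate point mass; the terms with its derivative live away from the pole. -/
theorem laplacian_logKernel {ε : ℝ} (hε : 0 < ε) (z w : ℂ) :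
    Laplacian.laplacian (fun w => logKernel ε (w - z)) w =
      innerKernel ε ‖w - z‖ + outerKernel ε (w - z) := by
  have hpos : ∀ s : ℝ, 0 ≤ s → s + ε ^ 2 ≠ 0 := fun s hs => by positivity
  have hlog : ∀ s : ℝ, 0 ≤ s → HasDerivAt (fun s => Real.log (s + ε ^ 2)) (1 / (s + ε ^ 2)) s :=
    fun s hs => ((hasDerivAt_id s).add_const (ε ^ 2)).log (hpos s hs)
  have hst : ∀ x, HasDerivAt stepDown (deriv stepDown x) x := fun x =>
    ((contDiff_stepDown.differentiable (by simp)) x).hasDerivAt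
  have h := laplacian_radial (F := fun s => truncId (Real.log (s + ε ^ 2)))
    (F' := fun s => stepDown (Real.log (s + ε ^ 2)) * (1 / (s + ε ^ 2)))
    (F'' := fun s => deriv stepDown (Real.log (s + ε ^ 2)) * (1 / (s + ε ^ 2)) * (1 / (s + ε ^ 2)) +
      stepDown (Real.log (s + ε ^ 2)) * ((0 * (s + ε ^ 2) - 1 * 1) / (s + ε ^ 2) ^ 2))
    (fun s hs => (hasDerivAt_truncId _).comp s (hlog s hs))
    (fun s hs => ((hst _).comp s (hlog s hs)).mul
      ((hasDerivAt_const s (1 : ℝ)).div ((hasDerivAt_id s).add_const (ε ^ 2)) (hpos s hs))) z w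
  refine h.trans ?_
  have := hpos (‖w - z‖ ^ 2) (by positivity)
  simp only [innerKernel, outerKernel]
  field_simp
  ring

theorem innerKernel_nonneg (ε r : ℝ) : 0 ≤ innerKernel ε r :=
  mul_nonneg (stepDown_nonneg _) (by positivity)

theorem innerKernel_le (ε r : ℝ) : innerKernel ε r ≤ 4 * ε ^ 2 / (r ^ 2 + ε ^ 2) ^ 2 :=
  mul_le_of_le_one_left (by positivity) (stepDown_le_one _)

theorem innerKernel_eq_zero {ε r : ℝ} (hr : 1 < r) : innerKernel ε r = 0 := by
  rw [innerKernel, stepDown_of_nonneg (Real.log_nonneg (by nlinarith [sq_nonneg ε])), zero_mul]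

theorem measurable_innerKernel (ε : ℝ) : Measurable (innerKernel ε) := by
  have := contDiff_stepDown.continuous.measurable
  unfold innerKernel
  fun_prop

theorem continuous_innerKernel {ε : ℝ} (hε : 0 < ε) : Continuous (innerKernel ε) := by
  have := contDiff_stepDown.continuous
  unfold innerKernel
  refine Continuous.mul (this.comp (Continuous.log (by fun_prop) fun r => by positivity)) ?_
  exact continuous_const.div (by fun_prop) fun r => by positivity

/-- The derivative of `stepDown` at log s vanishes for s near 0 and for s ≥ 1, so this kernel has no
singularity and stays continuous up to ε = 0. -/
theorem exists_continuous_outerKernel : ∃ G : ℝ → ℝ, Continuous G ∧ (∀ s, 1 ≤ s → G s = 0) ∧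
    (∃ B, ∀ s, 0 ≤ s → |G s| ≤ B) ∧
    ∀ ε w, outerKernel ε w = 4 * ‖w‖ ^ 2 * G (‖w‖ ^ 2 + ε ^ 2) := by
  have hc : Continuous (deriv stepDown) := contDiff_stepDown.continuous_deriv (by simp)
  have hG : Continuous fun s : ℝ => deriv stepDown (Real.log s) / s ^ 2 := by
    rw [continuous_iff_continuousAt]
    intro s
    by_cases hs : s = 0
    · subst hs
      -- `Real.log` is even, so negative s behave like |s|; at s = 0 the quotient is 0 because the
      -- denominator is.
      have h1 : (fun s : ℝ => deriv stepDown (Real.log s) / s ^ 2) =ᶠ[𝓝 0] fun _ => 0 := by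
        have h2 : Ioo (-Real.exp (-1)) (Real.exp (-1)) ∈ 𝓝 (0 : ℝ) :=
          Ioo_mem_nhds (by simp [Real.exp_pos]) (Real.exp_pos _)
        filter_upwards [h2] with s hs
        by_cases hs0 : s = 0
        · simp [hs0]
        · rw [deriv_stepDown_of_lt, zero_div]
          rw [← Real.log_abs, Real.log_lt_iff_lt_exp (abs_pos.2 hs0)]
          exact abs_lt.2 hs
      exact (continuousAt_const (y := (0 : ℝ))).congr h1.symm
    · exact (hc.continuousAt.comp (Real.continuousAt_log hs)).div (by fun_prop) (by positivity)
  have h0 : ∀ s : ℝ, 1 ≤ s → deriv stepDown (Real.log s) / s ^ 2 = 0 := fun s hs => by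
    rw [deriv_stepDown_of_nonneg (Real.log_nonneg hs), zero_div]
  obtain ⟨B, hB⟩ := isCompact_Icc.exists_bound_of_continuousOn (s := Icc (0 : ℝ) 1) hG.continuousOn
  refine ⟨_, hG, h0, ⟨B, fun s hs => ?_⟩, fun ε w => rfl⟩
  rcases le_total 1 s with h | h
  · have := hB 0 (by simp)
    rw [h0 s h, abs_zero]
    exact (norm_nonneg _).trans this
  · exact hB s ⟨hs, h⟩

theorem IsSubharmonic.continuousAt_integral_outerKernel {u : ℂ → EReal} (hu : IsSubharmonic u)
    (hne : ∃ z, u z ≠ ⊥) (z₀ : ℂ) :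
    ContinuousAt (fun p : ℝ × ℂ => ∫ w, (u w).toReal * outerKernel p.1 (w - p.2)) (0, z₀) := by
  obtain ⟨G, hG, hG0, ⟨B, hB⟩, hGe⟩ := exists_continuous_outerKernel
  simp only [hGe]
  have hg := (hu.locallyIntegrable hne).integrableOn_isCompact (isCompact_closedBall z₀ 2)
  -- Radius 2 is 1 for the support of the kernel plus 1 for the motion of the centre. On that
  -- support |w - p.2| < 1, whence the factor 4B.
  refine continuousAt_of_dominated
    (bound := (closedBall z₀ 2).indicator fun w => |(u w).toReal| * (4 * B)) ?_ ?_ ?_ ?_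
  · refine Eventually.of_forall fun p => ?_
    refine (hu.measurable.ereal_toReal.mul (Continuous.measurable ?_)).aestronglyMeasurable
    fun_prop
  · have h1 : ∀ᶠ p : ℝ × ℂ in 𝓝 (0, z₀), dist p.2 z₀ < 1 :=
      (continuous_snd.tendsto ((0 : ℝ), z₀)).eventually
        (Metric.eventually_nhds_iff.2 ⟨1, one_pos, fun y hy => hy⟩)
    filter_upwards [h1] with p hp
    refine ae_of_all _ fun w => ?_
    by_cases hw : 1 ≤ ‖w - p.2‖
    · rw [hG0 _ (by nlinarith [sq_nonneg p.1])]
      simp only [mul_zero, norm_zero]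
      refine indicator_nonneg (fun w _ => ?_) w
      have : 0 ≤ B := (abs_nonneg _).trans (hB 0 le_rfl)
      positivity
    · rw [not_le] at hw
      have hwb : w ∈ closedBall z₀ 2 := by
        rw [mem_closedBall]
        have := dist_triangle w p.2 z₀
        rw [dist_eq_norm w p.2] at this
        linarith
      rw [indicator_of_mem hwb, norm_mul, Real.norm_eq_abs, norm_mul]
      refine mul_le_mul_of_nonneg_left ?_ (abs_nonneg _)
      have h2 : ‖(4 * ‖w - p.2‖ ^ 2 : ℝ)‖ ≤ 4 := by
        rw [Real.norm_of_nonneg (by positivity)]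
        nlinarith [norm_nonneg (w - p.2)]
      exact mul_le_mul h2 (hB _ (by positivity)) (norm_nonneg _) (by norm_num)
  · exact IntegrableOn.integrable_indicator (hg.abs.mul_const _) measurableSet_closedBall
  · refine ae_of_all _ fun w => Continuous.continuousAt ?_
    fun_prop

theorem integrable_innerKernel (u : ℂ → EReal) (hu : IsSubharmonic u) (hne : ∃ z, u z ≠ ⊥) {ε : ℝ}
    (hε : 0 < ε) (z : ℂ) : Integrable fun w => (u w).toReal * innerKernel ε ‖w - z‖ := by
  refine hu.integrable_mul hne ((continuous_innerKernel hε).comp (by fun_prop)) ?_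
  refine HasCompactSupport.intro (isCompact_closedBall z 1) fun w hw => innerKernel_eq_zero ?_
  rw [mem_closedBall, not_le, dist_eq_norm] at hw
  exact hw

/-- A regularised local Riesz decomposition: as ε → 0 the inner term plays the role of a positive
multiple of u(z), and the outer term is continuous in z. -/
theorem IsLaplacian.integral_logKernel {u : ℂ → EReal} {μ : Measure ℂ} (hμ : IsLaplacian u μ)
    (hu : IsSubharmonic u) (hne : ∃ z, u z ≠ ⊥) {ε : ℝ} (hε : 0 < ε) (z : ℂ) :
    ∫ w, logKernel ε (w - z) ∂μ = (∫ w, (u w).toReal * innerKernel ε ‖w - z‖) +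
      ∫ w, (u w).toReal * outerKernel ε (w - z) := by
  have hsub : ContDiff ℝ (⊤ : ℕ∞) fun w : ℂ => w - z := contDiff_id.sub contDiff_const
  have h0 : ∀ w ∉ closedBall z 1, logKernel ε (w - z) = 0 := fun w hw => by
    rw [mem_closedBall, not_le, dist_eq_norm] at hw
    exact logKernel_eq_zero hw.le
  rw [hμ.integral_eq (fun w => logKernel ε (w - z)) ((contDiff_logKernel hε).comp hsub)
    (HasCompactSupport.intro (isCompact_closedBall z 1) h0),
    ← integral_add (integrable_innerKernel u hu hne hε z)]
  · refine integral_congr_ae (ae_of_all _ fun w => ?_)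
    dsimp only
    rw [← mul_add, ← laplacian_logKernel hε]
  · obtain ⟨G, hG, hG0, -, hGe⟩ := exists_continuous_outerKernel
    refine hu.integrable_mul hne (ψ := fun w => outerKernel ε (w - z)) ?_ ?_
    · simp only [hGe]; fun_prop
    · refine HasCompactSupport.intro (isCompact_closedBall z 1) fun w hw => ?_
      rw [mem_closedBall, not_le, dist_eq_norm] at hw
      rw [hGe, hG0 _ (by nlinarith [sq_nonneg ε]), mul_zero]

/-- Substituting w = εy turns the kernel into 4/(1 + |y|²)² times a factor tending to 1, with
domination by the first factor. The limit is 4π, but only its positivity matters. -/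
theorem exists_tendsto_integral_innerKernel : ∃ m : ℝ, 0 < m ∧
    Tendsto (fun ε => ∫ w : ℂ, innerKernel ε ‖w‖) (𝓝[>] 0) (𝓝 m) := by
  have hI : Integrable fun y : ℂ => 4 * (1 + ‖y‖ ^ 2) ^ (-(4 : ℝ) / 2) :=
    (integrable_rpow_neg_one_add_norm_sq (μ := volume) (E := ℂ) (r := 4)
      (by simp [Complex.finrank_real_complex]; norm_num)).const_mul 4
  have hrp : ∀ y : ℂ, 4 * (1 + ‖y‖ ^ 2) ^ (-(4 : ℝ) / 2) = 4 / (1 + ‖y‖ ^ 2) ^ 2 := fun y => by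
    have : (0 : ℝ) < 1 + ‖y‖ ^ 2 := by positivity
    rw [show (-(4 : ℝ) / 2) = -((2 : ℕ) : ℝ) by norm_num, Real.rpow_neg this.le, Real.rpow_natCast]
    rfl
  simp only [hrp] at hI
  refine ⟨∫ y : ℂ, 4 / (1 + ‖y‖ ^ 2) ^ 2, ?_, ?_⟩
  · refine (integral_pos_iff_support_of_nonneg (fun y => by positivity) hI).2 ?_
    have : Function.support (fun y : ℂ => 4 / (1 + ‖y‖ ^ 2) ^ 2) = univ := by
      ext y
      simp only [Function.mem_support, mem_univ, iff_true]
      positivity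
    rw [this]; simp
  · have hscale : ∀ ε : ℝ, 0 < ε → ∫ w : ℂ, innerKernel ε ‖w‖ =
        ∫ y : ℂ, stepDown (Real.log (ε ^ 2 * (1 + ‖y‖ ^ 2))) * (4 / (1 + ‖y‖ ^ 2) ^ 2) := by
      intro ε hε
      have h1 := Measure.integral_comp_smul (volume : Measure ℂ)
        (fun w : ℂ => innerKernel ε ‖w‖) ε
      rw [Complex.finrank_real_complex, abs_of_pos (by positivity), smul_eq_mul,
        eq_inv_mul_iff_mul_eq₀ (by positivity), ← integral_const_mul] at h1
      rw [← h1]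
      refine integral_congr_ae (ae_of_all _ fun y => ?_)
      dsimp only
      rw [innerKernel, norm_smul, Real.norm_of_nonneg hε.le,
        show (ε * ‖y‖) ^ 2 + ε ^ 2 = ε ^ 2 * (1 + ‖y‖ ^ 2) by ring]
      field_simp
    refine Tendsto.congr' (eventually_mem_nhdsWithin.mono fun ε hε => (hscale ε hε).symm) ?_
    refine tendsto_integral_filter_of_dominated_convergence
      (fun y : ℂ => 4 / (1 + ‖y‖ ^ 2) ^ 2) ?_ ?_ hI ?_
    · refine Eventually.of_forall fun ε => Measurable.aestronglyMeasurable ?_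
      have := contDiff_stepDown.continuous.measurable
      fun_prop
    · refine Eventually.of_forall fun ε => ae_of_all _ fun y => ?_
      rw [Real.norm_of_nonneg (mul_nonneg (stepDown_nonneg _) (by positivity))]
      exact mul_le_of_le_one_left (by positivity) (stepDown_le_one _)
    · refine ae_of_all _ fun y => ?_
      refine tendsto_const_nhds.congr' ?_
      have h1 : Tendsto (fun ε : ℝ => ε ^ 2 * (1 + ‖y‖ ^ 2)) (𝓝[>] 0) (𝓝 0) := by
        have : Continuous fun ε : ℝ => ε ^ 2 * (1 + ‖y‖ ^ 2) := by fun_prop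
        have h2 := (this.tendsto 0).mono_left (nhdsWithin_le_nhds (s := Ioi 0))
        simpa using h2
      filter_upwards [h1.eventually (eventually_lt_nhds (Real.exp_pos (-1))),
        eventually_mem_nhdsWithin] with ε h2 h3
      have h4 : 0 < ε ^ 2 * (1 + ‖y‖ ^ 2) := by
        have : 0 < ε := h3
        positivity
      rw [stepDown_of_le ((Real.log_lt_iff_lt_exp h4).2 h2).le, one_mul]

theorem IsSubharmonic.mul_integral_innerKernel_le {u : ℂ → EReal} (hu : IsSubharmonic u) {z : ℂ}
    (hz : u z ≠ ⊥) {ε : ℝ} (hε : 0 < ε) : (u z).toReal * ∫ w : ℂ, innerKernel ε ‖w‖ ≤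
      ∫ w, (u w).toReal * innerKernel ε ‖w - z‖ := by
  refine hu.mul_integral_radial_le hz (measurable_innerKernel ε) (innerKernel_nonneg ε)
    (B := 4 / ε ^ 2) (R := 1) (fun r => (innerKernel_le ε r).trans ?_)
    fun r hr => innerKernel_eq_zero hr
  rw [div_le_div_iff₀ (by positivity) (by positivity)]
  nlinarith [sq_nonneg r, mul_nonneg (sq_nonneg r) (sq_nonneg ε), sq_nonneg (r ^ 2)]

/-- Upper semicontinuity gives u < c on a disc of radius ρ; outside it the kernel is at most 4ε²/ρ⁴,
which gives the error term. -/
theorem IsSubharmonic.exists_integral_innerKernel_le {u : ℂ → EReal} (hu : IsSubharmonic u)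
    (hne : ∃ z, u z ≠ ⊥) {z : ℂ} {c : ℝ} (hz : u z < c) : ∃ A : ℝ, ∀ ε, 0 < ε →
      ∫ w, (u w).toReal * innerKernel ε ‖w - z‖ ≤
        c * (∫ w : ℂ, innerKernel ε ‖w‖) + A * ε ^ 2 := by
  obtain ⟨ρ, hρ, hρ'⟩ := Metric.eventually_nhds_iff.1 (hu.upperSemicontinuous z c hz)
  have hg : IntegrableOn (fun w => |(u w).toReal - c|) (closedBall z 1) :=
    (((hu.locallyIntegrable hne).integrableOn_isCompact (isCompact_closedBall z 1)).sub
      (integrableOn_const measure_closedBall_lt_top.ne)).abs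
  refine ⟨(∫ w in closedBall z 1, |(u w).toReal - c|) * (4 / ρ ^ 4), fun ε hε => ?_⟩
  have hk : ∫ w : ℂ, innerKernel ε ‖w‖ = ∫ w, innerKernel ε ‖w - z‖ :=
    (integral_sub_right_eq_self (fun w : ℂ => innerKernel ε ‖w‖) z).symm
  have h0 : ∀ w ∉ closedBall z 1, innerKernel ε ‖w - z‖ = 0 := fun w hw => by
    rw [mem_closedBall, not_le, dist_eq_norm] at hw
    exact innerKernel_eq_zero hw
  have hki : Integrable fun w => innerKernel ε ‖w - z‖ :=
    ((continuous_innerKernel hε).comp (by fun_prop)).integrable_of_hasCompactSupport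
      (HasCompactSupport.intro (isCompact_closedBall z 1) h0)
  have hui := integrable_innerKernel u hu hne hε z
  rw [hk, ← integral_const_mul, ← sub_le_iff_le_add', ← integral_sub hui (hki.const_mul c),
    mul_assoc, ← integral_mul_const, ← integral_indicator measurableSet_closedBall]
  refine integral_mono_ae (hui.sub (hki.const_mul c))
    (IntegrableOn.integrable_indicator (hg.mul_const _) measurableSet_closedBall) ?_
  filter_upwards [hu.ae_ne_bot hne] with w hw
  by_cases hwb : w ∈ closedBall z 1
  · rw [indicator_of_mem hwb, ← sub_mul]
    by_cases hwρ : dist w z < ρ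
    · have h1 := EReal.toReal_le_of_le_coe hw (hρ' hwρ).le
      refine (mul_nonpos_of_nonpos_of_nonneg (sub_nonpos.2 h1) (innerKernel_nonneg _ _)).trans ?_
      positivity
    · rw [dist_eq_norm, not_lt] at hwρ
      refine (mul_le_mul_of_nonneg_right (le_abs_self _) (innerKernel_nonneg _ _)).trans ?_
      refine mul_le_mul_of_nonneg_left ((innerKernel_le _ _).trans ?_) (abs_nonneg _)
      rw [div_mul_eq_mul_div]
      refine div_le_div_of_nonneg_left (by positivity) (by positivity) ?_
      have h2 : ρ ^ 2 ≤ ‖w - z‖ ^ 2 + ε ^ 2 := by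
        have := pow_le_pow_left₀ hρ.le hwρ 2
        nlinarith [sq_nonneg ε]
      calc ρ ^ 4 = (ρ ^ 2) ^ 2 := by ring
        _ ≤ _ := pow_le_pow_left₀ (by positivity) h2 2
  · rw [indicator_of_notMem hwb, h0 w hwb]
    simp

/-! ### Averaging the logarithmic pole over radii -/

/-- The truncated logarithmic pole, with value `∞` at the origin. -/
noncomputable def logPole (x : ℝ) : ENNReal :=
  if x = 0 then ⊤ else ENNReal.ofReal (-truncId (Real.log (x ^ 2)))

theorem measurable_logPole : Measurable logPole := by
  have := contDiff_truncId.continuous.measurable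
  refine Measurable.ite (measurableSet_singleton 0) measurable_const ?_
  fun_prop

theorem logPole_eq_zero {x : ℝ} (hx : 1 ≤ |x|) : logPole x = 0 := by
  have hx2 : 1 ≤ x ^ 2 := by rw [← sq_abs]; nlinarith
  rw [logPole, if_neg (by rintro rfl; norm_num at hx), truncId_of_nonneg (Real.log_nonneg hx2)]
  simp

theorem ofReal_neg_logKernel_le {ε : ℝ} {w : ℂ} {x : ℝ} (hx : |x| ≤ ‖w‖) :
    ENNReal.ofReal (-logKernel ε w) ≤ logPole x := by
  rw [logPole]
  split_ifs with h
  · exact le_top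
  · refine ENNReal.ofReal_le_ofReal (neg_le_neg (truncId_mono (Real.log_le_log (by positivity) ?_)))
    have := pow_le_pow_left₀ (abs_nonneg x) hx 2
    rw [sq_abs] at this
    nlinarith [sq_nonneg ε]

theorem tendsto_ofReal_neg_logKernel (w : ℂ) :
    Tendsto (fun ε => ENNReal.ofReal (-logKernel ε w)) (𝓝[>] 0) (𝓝 (logPole ‖w‖)) := by
  have hc : Tendsto (fun ε : ℝ => ‖w‖ ^ 2 + ε ^ 2) (𝓝[>] 0) (𝓝 (‖w‖ ^ 2)) := by
    have : Continuous fun ε : ℝ => ‖w‖ ^ 2 + ε ^ 2 := by fun_prop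
    have h2 := (this.tendsto 0).mono_left (nhdsWithin_le_nhds (s := Ioi 0))
    simpa using h2
  rw [logPole]
  split_ifs with h
  · rw [h] at hc
    refine ENNReal.tendsto_ofReal_atTop.comp ?_
    have h1 : Tendsto (fun ε : ℝ => Real.log (‖w‖ ^ 2 + ε ^ 2)) (𝓝[>] 0) atBot := by
      refine Real.tendsto_log_nhdsGT_zero.comp (tendsto_nhdsWithin_iff.2 ⟨?_, ?_⟩)
      · simpa [h] using hc
      · filter_upwards [eventually_mem_nhdsWithin] with ε hε
        have : 0 < ε := hε
        show 0 < ‖w‖ ^ 2 + ε ^ 2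
        positivity
    have h2 : Tendsto (fun ε : ℝ => -Real.log (‖w‖ ^ 2 + ε ^ 2) - 1) (𝓝[>] 0) atTop :=
      tendsto_atTop_add_const_right _ _ (tendsto_neg_atBot_atTop.comp h1)
    refine tendsto_atTop_mono (fun ε => ?_) h2
    have := truncId_le (Real.log (‖w‖ ^ 2 + ε ^ 2))
    rw [logKernel]
    linarith
  · refine ENNReal.tendsto_ofReal (Tendsto.neg ?_)
    have h1 : ContinuousAt (fun s => truncId (Real.log s)) (‖w‖ ^ 2) :=
      contDiff_truncId.continuous.continuousAt.comp (Real.continuousAt_log (pow_ne_zero 2 h))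
    exact h1.tendsto.comp hc

/-- `truncId` is increasing and 1-Lipschitz, so the truncated pole grows by no more than the
logarithm itself; the excess depends only on the ratio r/t. -/
theorem logPole_sub_le {r t : ℝ} (ht : 0 < t) (hr : r ≠ t) :
    logPole (r - t) ≤ logPole t + ENNReal.ofReal (-Real.log (((r - t) / t) ^ 2)) := by
  have hrt : r - t ≠ 0 := sub_ne_zero.2 hr
  rw [logPole, logPole, if_neg hrt, if_neg ht.ne']
  have hlog : -Real.log (((r - t) / t) ^ 2) = Real.log (t ^ 2) - Real.log ((r - t) ^ 2) := by
    rw [div_pow, Real.log_div (by positivity) (by positivity)]; ring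
  rcases le_total (Real.log (t ^ 2)) (Real.log ((r - t) ^ 2)) with h | h
  · exact (ENNReal.ofReal_le_ofReal (neg_le_neg (truncId_mono h))).trans le_self_add
  · rw [← ENNReal.ofReal_add (neg_nonneg.2 (truncId_nonpos _)) (by rw [hlog]; linarith)]
    refine ENNReal.ofReal_le_ofReal ?_
    rw [hlog]
    linarith [truncId_sub_le h]

theorem lintegral_neg_log_sq_lt_top : ∫⁻ x : ℝ, ENNReal.ofReal (-Real.log (x ^ 2)) < ⊤ := by
  have h1 : ∫⁻ x : ℝ, ENNReal.ofReal (-Real.log (x ^ 2)) =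
      ∫⁻ x in Ioc (-1 : ℝ) 1, ENNReal.ofReal (-Real.log (x ^ 2)) := by
    rw [← lintegral_indicator measurableSet_Ioc]
    refine lintegral_congr fun x => ?_
    by_cases hx : x ∈ Ioc (-1 : ℝ) 1
    · rw [indicator_of_mem hx]
    · rw [indicator_of_notMem hx, ENNReal.ofReal_eq_zero, neg_nonpos]
      refine Real.log_nonneg ?_
      rw [mem_Ioc, not_and_or, not_lt, not_le] at hx
      rcases hx with hx | hx <;> nlinarith
  rw [h1]
  have h2 : IntegrableOn (fun x : ℝ => -Real.log (x ^ 2)) (Ioc (-1) 1) := by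
    have h3 : IntervalIntegrable Real.log volume (-1) 1 := intervalIntegral.intervalIntegrable_log'
    have h4 := (h3.const_mul (-2)).1
    refine h4.congr_fun (fun x _ => ?_) measurableSet_Ioc
    simp [Real.log_pow]
  exact h2.lintegral_lt_top

theorem lintegral_neg_log_div_sq {t : ℝ} (ht : 0 < t) :
    ∫⁻ r : ℝ, ENNReal.ofReal (-Real.log (((r - t) / t) ^ 2)) =
      ENNReal.ofReal t * ∫⁻ x : ℝ, ENNReal.ofReal (-Real.log (x ^ 2)) := by
  rw [lintegral_sub_right_eq_self (fun r : ℝ => ENNReal.ofReal (-Real.log ((r / t) ^ 2))) t]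
  have hm : Measurable fun x : ℝ => ENNReal.ofReal (-Real.log (x ^ 2)) := by fun_prop
  have h1 := lintegral_map (μ := volume) hm (measurable_const_mul t⁻¹)
  rw [Real.map_volume_mul_left (inv_ne_zero ht.ne'), inv_inv, abs_of_pos ht,
    lintegral_smul_measure, smul_eq_mul] at h1
  rw [h1]
  refine lintegral_congr fun r => ?_
  rw [inv_mul_eq_div]

/-- The error made in replacing an average of `logPole` over an interval of length `s` by its value
at a distance `t`. -/
noncomputable def poleError (s t : ℝ) : ENNReal :=
  if 2 * s < t then ENNReal.ofReal (4 * s / t)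
  else 2 * ∫⁻ x : ℝ, ENNReal.ofReal (-Real.log (x ^ 2))

theorem measurable_poleError (s : ℝ) : Measurable (poleError s) := by
  refine Measurable.ite measurableSet_Ioi ?_ measurable_const
  fun_prop

theorem poleError_le (s : ℝ) {t : ℝ} (ht : 0 ≤ t) :
    poleError s t ≤ 2 + 2 * ∫⁻ x : ℝ, ENNReal.ofReal (-Real.log (x ^ 2)) := by
  rw [poleError]
  split_ifs with h
  · refine le_trans ?_ le_self_add
    rcases ht.eq_or_lt with rfl | ht
    · simp
    · rw [show (2 : ENNReal) = ENNReal.ofReal 2 by simp]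
      refine ENNReal.ofReal_le_ofReal ?_
      rw [div_le_iff₀ ht]
      linarith
  · exact le_add_self

/-- If t > 2s, then r/t < 1/2 and the excess -2 log(1 - r/t) is at most 4r/t. Otherwise, scaling by
t bounds the integrated excess by t ≤ 2s times a finite constant. -/
theorem lintegral_logPole_le {s t : ℝ} (hs : 0 < s) (ht : 0 < t) :
    ∫⁻ r in Ioo 0 s, logPole (r - t) ≤ ENNReal.ofReal s * (logPole t + poleError s t) := by
  have hne : ∀ᵐ r : ℝ ∂volume.restrict (Ioo 0 s), r ≠ t :=
    ae_restrict_of_ae (Measure.ae_ne volume t)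
  have h1 : ∫⁻ r in Ioo 0 s, logPole (r - t) ≤ ∫⁻ r in Ioo 0 s, (logPole t +
      ENNReal.ofReal (-Real.log (((r - t) / t) ^ 2))) :=
    lintegral_mono_ae (hne.mono fun r hr => logPole_sub_le ht hr)
  refine h1.trans ?_
  rw [lintegral_add_left measurable_const, setLIntegral_const, Real.volume_Ioo, sub_zero, mul_add,
    mul_comm]
  refine add_le_add_right ?_ _
  rw [poleError]
  split_ifs with h
  · have h2 : ∫⁻ r in Ioo 0 s, ENNReal.ofReal (-Real.log (((r - t) / t) ^ 2)) ≤
        ∫⁻ r in Ioo 0 s, ENNReal.ofReal (4 * s / t) := by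
      refine setLIntegral_mono measurable_const fun r hr => ENNReal.ofReal_le_ofReal ?_
      have hrt : r / t ≤ 1 / 2 := by
        rw [div_le_iff₀ ht]; linarith [hr.2]
      have hrt0 : 0 < r / t := div_pos hr.1 ht
      have h3 : ((r - t) / t) ^ 2 = (1 - r / t) ^ 2 := by
        field_simp; ring
      rw [h3, Real.log_pow]
      have h4 := Real.one_sub_inv_le_log_of_pos (show 0 < 1 - r / t by linarith)
      have h5 : (1 - r / t)⁻¹ ≤ 1 + 2 * (r / t) := by
        rw [inv_le_iff_one_le_mul₀ (by linarith)]
        nlinarith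
      have h6 : r / t ≤ s / t := div_le_div_of_nonneg_right hr.2.le ht.le
      rw [mul_div_assoc]
      push_cast
      linarith
    refine h2.trans (le_of_eq ?_)
    rw [setLIntegral_const, Real.volume_Ioo, sub_zero, mul_comm]
  · refine (setLIntegral_le_lintegral _ _).trans ?_
    rw [lintegral_neg_log_div_sq ht, ← mul_assoc]
    refine mul_le_mul_left ?_ _
    rw [show (2 : ENNReal) = ENNReal.ofReal 2 by simp, ← ENNReal.ofReal_mul hs.le]
    exact ENNReal.ofReal_le_ofReal (by linarith)

/-- The error is bounded uniformly in s and tends to 0 at every w ≠ z₀; the absence of an atom at z₀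
makes this almost everywhere convergence. -/
theorem tendsto_lintegral_poleError {μ : Measure ℂ} [IsFiniteMeasureOnCompacts μ] {z₀ : ℂ}
    (h0 : μ {z₀} = 0) : Tendsto (fun s => ∫⁻ w in closedBall z₀ 2, poleError s ‖w - z₀‖ ∂μ)
      (𝓝[>] 0) (𝓝 0) := by
  have h := tendsto_lintegral_filter_of_dominated_convergence (μ := μ.restrict (closedBall z₀ 2))
    (l := 𝓝[>] (0 : ℝ)) (F := fun s w => poleError s ‖w - z₀‖) (f := fun _ => 0)
    (fun _ => 2 + 2 * ∫⁻ x : ℝ, ENNReal.ofReal (-Real.log (x ^ 2)))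
    (Eventually.of_forall fun s => (measurable_poleError s).comp (by fun_prop))
    (Eventually.of_forall fun s => ae_of_all _ fun w => poleError_le s (norm_nonneg _)) ?_ ?_
  · simpa using h
  · rw [lintegral_const]
    refine ENNReal.mul_ne_top ?_ ?_
    · exact ENNReal.add_ne_top.2 ⟨by simp, ENNReal.mul_ne_top (by simp)
        lintegral_neg_log_sq_lt_top.ne⟩
    · rw [Measure.restrict_apply_univ]
      exact (isCompact_closedBall z₀ 2).measure_lt_top.ne
  · have hne : ∀ᵐ w ∂μ.restrict (closedBall z₀ 2), w ≠ z₀ := by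
      refine ae_restrict_of_ae ?_
      rw [ae_iff]
      simpa using h0
    filter_upwards [hne] with w hw
    have hw' : 0 < ‖w - z₀‖ := norm_pos_iff.2 (sub_ne_zero.2 hw)
    have h1 : Tendsto (fun s : ℝ => ENNReal.ofReal (4 * s / ‖w - z₀‖)) (𝓝[>] 0) (𝓝 0) := by
      have : Continuous fun s : ℝ => ENNReal.ofReal (4 * s / ‖w - z₀‖) :=
        ENNReal.continuous_ofReal.comp (by fun_prop)
      have h2 := (this.tendsto 0).mono_left (nhdsWithin_le_nhds (s := Ioi 0))
      simpa using h2
    refine h1.congr' ?_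
    have h3 : ∀ᶠ s : ℝ in 𝓝[>] 0, s < ‖w - z₀‖ / 2 :=
      nhdsWithin_le_nhds (eventually_lt_nhds (half_pos hw'))
    filter_upwards [h3] with s hs
    rw [poleError, if_pos (by linarith)]

theorem lintegral_ofReal_neg_logKernel {μ : Measure ℂ} [IsFiniteMeasureOnCompacts μ] {ε : ℝ}
    (hε : 0 < ε) (z : ℂ) : ∫⁻ w, ENNReal.ofReal (-logKernel ε (w - z)) ∂μ =
      ENNReal.ofReal (-∫ w, logKernel ε (w - z) ∂μ) := by
  have hi : Integrable (fun w => logKernel ε (w - z)) μ := by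
    refine Continuous.integrable_of_hasCompactSupport
      ((contDiff_logKernel hε).continuous.comp (by fun_prop)) ?_
    refine HasCompactSupport.intro (isCompact_closedBall z 1) fun w hw => ?_
    rw [mem_closedBall, not_le, dist_eq_norm] at hw
    exact logKernel_eq_zero hw.le
  have hi' : Integrable (fun w => -logKernel ε (w - z)) μ := hi.neg
  rw [← integral_neg, ofReal_integral_eq_lintegral_ofReal hi'
    (ae_of_all _ fun w => neg_nonneg.2 (logKernel_nonpos _ _))]

/-! ### Sets meeting all small circles are not thin -/

/-- The potential at z₀ is bounded above by the value u(z₀) and, after circular projection and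
averaging over radii, bounded below by the values at the given points of the circles. Comparing the
two bounds gives the inequality. -/
theorem IsSubharmonic.le_of_forall_sphere {u : ℂ → EReal} (hu : IsSubharmonic u) {z₀ : ℂ} {c ρ : ℝ}
    (hρ : 0 < ρ) (h : ∀ r, 0 < r → r < ρ → ∃ z ∈ sphere z₀ r, u z ≤ c) : u z₀ ≤ c := by
  by_cases hbot : u z₀ = ⊥
  · rw [hbot]; exact bot_le
  have hne : ∃ z, u z ≠ ⊥ := ⟨z₀, hbot⟩
  obtain ⟨μ, hμ⟩ := hu.exists_isLaplacian hne
  have : IsFiniteMeasureOnCompacts μ := ⟨hμ.finite_of_isCompact⟩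
  obtain ⟨m, hm, hmt⟩ := exists_tendsto_integral_innerKernel
  set H : ℝ × ℂ → ℝ := fun p => ∫ w, (u w).toReal * outerKernel p.1 (w - p.2) with hH
  have hHc : ∀ z, Tendsto (fun ε => H (ε, z)) (𝓝[>] 0) (𝓝 (H (0, z))) := fun z => by
    have h1 : Tendsto (fun ε : ℝ => (ε, z)) (𝓝[>] 0) (𝓝 (0, z)) := by
      have : Continuous fun ε : ℝ => (ε, z) := by fun_prop
      exact (this.tendsto 0).mono_left nhdsWithin_le_nhds
    exact (hu.continuousAt_integral_outerKernel hne z).tendsto.comp h1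
  have hεpos : ∀ᶠ ε : ℝ in 𝓝[>] 0, 0 < ε := eventually_mem_nhdsWithin
  set X := -((u z₀).toReal * m + H (0, z₀)) with hX
  have hXlim : Tendsto (fun ε => -((u z₀).toReal * (∫ w : ℂ, innerKernel ε ‖w‖) + H (ε, z₀)))
      (𝓝[>] 0) (𝓝 X) := ((hmt.const_mul _).add (hHc z₀)).neg
  have hle : ∀ᶠ ε in 𝓝[>] 0, -∫ w, logKernel ε (w - z₀) ∂μ ≤
      -((u z₀).toReal * (∫ w : ℂ, innerKernel ε ‖w‖) + H (ε, z₀)) := by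
    filter_upwards [hεpos] with ε hε
    rw [hμ.integral_logKernel hu hne hε]
    have := hu.mul_integral_innerKernel_le hbot hε
    simp only [hH]
    linarith
  have hX0 : 0 ≤ X := by
    refine ge_of_tendsto hXlim (hle.mono fun ε hε => le_trans ?_ hε)
    exact neg_nonneg.2 (integral_nonpos fun w => logKernel_nonpos _ _)
  -- Fatou's lemma, applied along ε = 1/(n + 1) because it needs a sequence.
  have hpole : ∫⁻ w, logPole ‖w - z₀‖ ∂μ ≤ ENNReal.ofReal X := by
    have h1 : ∀ w, logPole ‖w - z₀‖ =
        liminf (fun ε => ENNReal.ofReal (-logKernel ε (w - z₀))) (𝓝[>] 0) := fun w =>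
      (tendsto_ofReal_neg_logKernel (w - z₀)).liminf_eq.symm
    simp only [h1]
    have hseq : Tendsto (fun n : ℕ => 1 / ((n : ℝ) + 1)) atTop (𝓝[>] 0) :=
      tendsto_nhdsWithin_iff.2 ⟨tendsto_one_div_add_atTop_nhds_zero_nat,
        Eventually.of_forall fun n => by show (0 : ℝ) < 1 / (n + 1); positivity⟩
    have h2 : ∀ w, liminf (fun ε => ENNReal.ofReal (-logKernel ε (w - z₀))) (𝓝[>] 0) =
        liminf (fun n : ℕ => ENNReal.ofReal (-logKernel (1 / ((n : ℝ) + 1)) (w - z₀))) atTop :=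
      fun w => by
        rw [← h1 w]
        exact (((tendsto_ofReal_neg_logKernel (w - z₀)).comp hseq).liminf_eq).symm
    simp only [h2]
    refine (lintegral_liminf_le' fun n => ?_).trans ?_
    · have : Continuous (logKernel (1 / ((n : ℝ) + 1))) :=
        (contDiff_logKernel (by positivity)).continuous
      exact (by fun_prop : Measurable fun w =>
        ENNReal.ofReal (-logKernel (1 / ((n : ℝ) + 1)) (w - z₀))).aemeasurable
    · have h3 := (ENNReal.tendsto_ofReal hXlim).comp hseq
      rw [← h3.liminf_eq]
      refine liminf_le_liminf ?_
      filter_upwards [hseq.eventually (hle.and hεpos)] with n hn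
      rw [lintegral_ofReal_neg_logKernel hn.2]
      exact ENNReal.ofReal_le_ofReal hn.1
  -- An atom at z₀ would make the potential infinite there, as the pole takes the value ∞ at 0.
  have hatom : μ {z₀} = 0 := by
    by_contra hcon
    have h1 : ∫⁻ w in {z₀}, logPole ‖w - z₀‖ ∂μ = ⊤ := by
      rw [setLIntegral_congr_fun (g := fun _ => ⊤) (measurableSet_singleton z₀)
        (fun w hw => by
          rw [mem_singleton_iff] at hw
          simp [hw, logPole]), setLIntegral_const, ENNReal.top_mul hcon]
    have h2 := (setLIntegral_le_lintegral {z₀} fun w => logPole ‖w - z₀‖).trans hpole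
    rw [h1] at h2
    exact absurd h2 (by simp)
  have key : ∀ δ : ℝ, 0 < δ → -((c + δ) * m + H (0, z₀) + δ) ≤ X := by
    intro δ hδ
    have h1 : ∀ᶠ z in 𝓝 z₀, H (0, z) < H (0, z₀) + δ := by
      have h2 : Tendsto (fun z : ℂ => H (0, z)) (𝓝 z₀) (𝓝 (H (0, z₀))) := by
        have h3 : Tendsto (fun z : ℂ => ((0 : ℝ), z)) (𝓝 z₀) (𝓝 (0, z₀)) := by
          have : Continuous fun z : ℂ => ((0 : ℝ), z) := by fun_prop
          exact this.tendsto z₀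
        exact (hu.continuousAt_integral_outerKernel hne z₀).tendsto.comp h3
      exact h2.eventually (eventually_lt_nhds (by linarith))
    obtain ⟨ρ', hρ', hHρ⟩ := Metric.eventually_nhds_iff.1 h1
    -- Circular projection: for |z - z₀| = r, |w - z| ≥ |r - |w - z₀||, so the pole at w - z is
    -- dominated by a function of r and |w - z₀| alone. The bound no longer depends on which z was
    -- found.
    have hN : ∀ r, 0 < r → r < min ρ ρ' →
        ENNReal.ofReal (-((c + δ) * m + H (0, z₀) + δ)) ≤ ∫⁻ w, logPole (r - ‖w - z₀‖) ∂μ := by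
      intro r hr hrρ
      obtain ⟨z, hz, huz⟩ := h r hr (hrρ.trans_le (min_le_left _ _))
      have hzc : u z < ((c + δ : ℝ) : EReal) :=
        huz.trans_lt (by exact_mod_cast (by linarith : c < c + δ))
      obtain ⟨A, hA⟩ := hu.exists_integral_innerKernel_le hne hzc
      have hlim : Tendsto (fun ε : ℝ => ENNReal.ofReal (-((c + δ) * (∫ w : ℂ, innerKernel ε ‖w‖) +
          A * ε ^ 2 + H (ε, z)))) (𝓝[>] 0) (𝓝 (ENNReal.ofReal (-((c + δ) * m + A * 0 ^ 2 + H (0, z))))) := by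
        refine ENNReal.tendsto_ofReal (Tendsto.neg (((hmt.const_mul _).add ?_).add (hHc z)))
        have : Continuous fun ε : ℝ => A * ε ^ 2 := by fun_prop
        exact (this.tendsto 0).mono_left nhdsWithin_le_nhds
      have h3 : ENNReal.ofReal (-((c + δ) * m + A * 0 ^ 2 + H (0, z))) ≤
          ∫⁻ w, logPole (r - ‖w - z₀‖) ∂μ := by
        refine le_of_tendsto hlim ?_
        filter_upwards [hεpos] with ε hε
        have h4 : ∫⁻ w, ENNReal.ofReal (-logKernel ε (w - z)) ∂μ ≤
            ∫⁻ w, logPole (r - ‖w - z₀‖) ∂μ := by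
          refine lintegral_mono fun w => ofReal_neg_logKernel_le ?_
          have h5 := abs_norm_sub_norm_le (z - z₀) (w - z₀)
          rw [mem_sphere, dist_eq_norm] at hz
          rw [hz, sub_sub_sub_cancel_right, norm_sub_rev z w] at h5
          exact h5
        refine le_trans ?_ h4
        rw [lintegral_ofReal_neg_logKernel hε, hμ.integral_logKernel hu hne hε]
        refine ENNReal.ofReal_le_ofReal (neg_le_neg ?_)
        have := hA ε hε
        simp only [hH]
        linarith
      refine le_trans (ENNReal.ofReal_le_ofReal ?_) h3
      have h6 := hHρ (y := z) (by rw [mem_sphere.1 hz]; exact hrρ.trans_le (min_le_right _ _))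
      linarith
    -- Average the previous bound over r in (0, s) and exchange the integrals. Since s < 1, points
    -- at distance more than 2 from z₀ contribute nothing.
    have hE : ∀ s, 0 < s → s < min (min ρ ρ') 1 →
        ENNReal.ofReal (-((c + δ) * m + H (0, z₀) + δ)) ≤ ∫⁻ w, logPole ‖w - z₀‖ ∂μ +
          ∫⁻ w in closedBall z₀ 2, poleError s ‖w - z₀‖ ∂μ := by
      intro s hs hsρ
      have hs0 : ENNReal.ofReal s ≠ 0 := by simpa using hs
      rw [← ENNReal.mul_le_mul_iff_right hs0 ENNReal.ofReal_ne_top]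
      have hmE : Measurable fun w : ℂ => poleError s ‖w - z₀‖ :=
        (measurable_poleError s).comp (by fun_prop)
      have hmP : Measurable fun w : ℂ => logPole ‖w - z₀‖ :=
        measurable_logPole.comp (by fun_prop)
      calc ENNReal.ofReal s * ENNReal.ofReal (-((c + δ) * m + H (0, z₀) + δ))
          = ∫⁻ r in Ioo 0 s, ENNReal.ofReal (-((c + δ) * m + H (0, z₀) + δ)) := by
            rw [setLIntegral_const, Real.volume_Ioo, sub_zero, mul_comm]
        _ ≤ ∫⁻ r in Ioo 0 s, ∫⁻ w, logPole (r - ‖w - z₀‖) ∂μ := by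
            refine lintegral_mono_ae ?_
            filter_upwards [ae_restrict_mem measurableSet_Ioo] with r hr
            exact hN r hr.1 (hr.2.trans (hsρ.trans_le (min_le_left _ _)))
        _ = ∫⁻ w, (∫⁻ r in Ioo 0 s, logPole (r - ‖w - z₀‖)) ∂μ := by
            refine lintegral_lintegral_swap (Measurable.aemeasurable ?_)
            exact measurable_logPole.comp (by fun_prop)
        _ ≤ ∫⁻ w, ENNReal.ofReal s * (logPole ‖w - z₀‖ +
              (closedBall z₀ 2).indicator (fun w => poleError s ‖w - z₀‖) w) ∂μ := by
            have hne : ∀ᵐ w ∂μ, w ≠ z₀ := by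
              rw [ae_iff]
              simpa using hatom
            refine lintegral_mono_ae (hne.mono fun w hw => ?_)
            by_cases hwb : w ∈ closedBall z₀ 2
            · rw [indicator_of_mem hwb]
              exact lintegral_logPole_le hs (norm_pos_iff.2 (sub_ne_zero.2 hw))
            · rw [mem_closedBall, not_le, dist_eq_norm] at hwb
              have hs1 := hsρ.trans_le (min_le_right _ _)
              rw [setLIntegral_congr_fun (f := fun r : ℝ => logPole (r - ‖w - z₀‖))
                (g := fun _ => 0) measurableSet_Ioo fun r hr =>
                logPole_eq_zero (by rw [abs_of_neg] <;> linarith [hr.2])]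
              simp
        _ = ENNReal.ofReal s * (∫⁻ w, logPole ‖w - z₀‖ ∂μ +
              ∫⁻ w in closedBall z₀ 2, poleError s ‖w - z₀‖ ∂μ) := by
            rw [lintegral_const_mul' _ _ ENNReal.ofReal_ne_top, lintegral_add_left hmP,
              lintegral_indicator measurableSet_closedBall]
    have hfin : ENNReal.ofReal (-((c + δ) * m + H (0, z₀) + δ)) ≤
        ∫⁻ w, logPole ‖w - z₀‖ ∂μ + 0 := by
      refine ge_of_tendsto ((tendsto_lintegral_poleError hatom).const_add _) ?_
      have h7 : ∀ᶠ s : ℝ in 𝓝[>] 0, s < min (min ρ ρ') 1 :=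
        nhdsWithin_le_nhds (eventually_lt_nhds (lt_min (lt_min hρ hρ') one_pos))
      filter_upwards [hεpos, h7] with s hs hs'
      exact hE s hs hs'
    rw [add_zero] at hfin
    exact (ENNReal.ofReal_le_ofReal_iff hX0).1 (hfin.trans hpole)
  have hfinal : (u z₀).toReal ≤ c := by
    refine le_of_forall_pos_le_add fun η hη => ?_
    -- `key` loses δ(m + 1) in total; this choice makes the loss ηm.
    have h1 := key (η * m / (m + 1)) (by positivity)
    have h2 : (u z₀).toReal * m ≤ (c + η) * m := by
      have : η * m / (m + 1) * (m + 1) = η * m := by field_simp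
      nlinarith
    exact le_of_mul_le_mul_right h2 hm
  rw [← EReal.coe_toReal (hu.lt_top z₀).ne hbot]
  exact_mod_cast hfinal

/-! ### Compactly supported functions with zero Laplacian -/

theorem laplacian_comp_clm {F F' F'' : ℝ → ℝ} (hF : ∀ s, HasDerivAt F (F' s) s)
    (hF' : ∀ s, HasDerivAt F' (F'' s) s) (L : ℂ →L[ℝ] ℝ) (w : ℂ) :
    Laplacian.laplacian (fun w => F (L w)) w = (L 1 ^ 2 + L Complex.I ^ 2) * F'' (L w) := by
  have h1 : fderiv ℝ (fun w => F (L w)) = fun w => F' (L w) • L := funext fun w =>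
    ((hF _).comp_hasFDerivAt w L.hasFDerivAt).fderiv
  have h2 := ((hF' (L w)).comp_hasFDerivAt w L.hasFDerivAt).smul_const L
  have h3 : fderiv ℝ (fun w => F' (L w) • L) w = _ := h2.fderiv
  rw [laplacian_eq_fderiv_fderiv, h1, h3]
  simp
  ring

/-- As f vanishes off K, multiplying the test function by a cutoff equal to 1 near K changes
nothing; this admits plane waves and |w|² as test functions. -/
theorem integral_mul_laplacian_eq_zero_of_contDiff {f : ℂ → ℝ} {K : Set ℂ} (hK : IsCompact K)
    (hfK : ∀ z ∉ K, f z = 0)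
    (h : ∀ φ : ℂ → ℝ, ContDiff ℝ (⊤ : ℕ∞) φ → HasCompactSupport φ →
      ∫ z, f z * Laplacian.laplacian φ z = 0) {ψ : ℂ → ℝ} (hψ : ContDiff ℝ (⊤ : ℕ∞) ψ) :
    ∫ z, f z * Laplacian.laplacian ψ z = 0 := by
  obtain ⟨χ, hχ, hχc, hχ1, -, -⟩ := exists_contDiff_cutoff hK isOpen_univ (subset_univ K)
  rw [← h (fun z => χ z * ψ z) (hχ.mul hψ) hχc.mul_right]
  refine integral_congr_ae (ae_of_all _ fun z => ?_)
  dsimp only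
  by_cases hz : z ∈ K
  · congr 1
    have : (fun z => χ z * ψ z) =ᶠ[𝓝 z] ψ := (hχ1 z hz).mono fun w hw => by
      simp only [hw, one_mul]
    exact (InnerProductSpace.laplacian_congr_nhds this).eq_of_nhds.symm
  · simp [hfK z hz]

/-- A compactly supported integrable function with vanishing distributional Laplacian is zero. -/
theorem ae_eq_zero_of_forall_integral_mul_laplacian {f : ℂ → ℝ} {K : Set ℂ} (hK : IsCompact K)
    (hfm : Measurable f) (hf : Integrable f) (hfK : ∀ z ∉ K, f z = 0)
    (h : ∀ φ : ℂ → ℝ, ContDiff ℝ (⊤ : ℕ∞) φ → HasCompactSupport φ →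
      ∫ z, f z * Laplacian.laplacian φ z = 0) : f =ᵐ[volume] 0 := by
  have h' := fun ψ (hψ : ContDiff ℝ (⊤ : ℕ∞) ψ) =>
    integral_mul_laplacian_eq_zero_of_contDiff hK hfK h hψ
  -- Frequency zero needs its own test function, since constants have zero Laplacian: |w|² has
  -- Laplacian 4.
  have h0 : ∫ z, f z = 0 := by
    have h1 := h' (fun w => ‖w‖ ^ 2) (contDiff_norm_sq ℝ)
    have h2 : ∀ w : ℂ, Laplacian.laplacian (fun w : ℂ => ‖w‖ ^ 2) w = 4 := fun w => by
      have := laplacian_radial (F := fun s => s) (F' := fun _ => 1) (F'' := fun _ => 0)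
        (fun s _ => hasDerivAt_id s) (fun s _ => hasDerivAt_const s 1) 0 w
      simpa using this
    simp only [h2, integral_mul_const] at h1
    linarith
  have hwave : ∀ (F F' : ℝ → ℝ), ContDiff ℝ (⊤ : ℕ∞) F → (∀ s, HasDerivAt F (F' s) s) →
      (∀ s, HasDerivAt F' (-F s) s) → ∀ t : ℂ, t ≠ 0 → ∫ z, f z * F (inner ℝ t z) = 0 := by
    intro F F' hFc hF hF' t ht
    have h1 := h' (fun w => F (innerSL ℝ t w)) (hFc.comp (innerSL ℝ t).contDiff)
    have hlap : ∀ z, Laplacian.laplacian (fun w => F (innerSL ℝ t w)) z =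
        ((inner ℝ t 1 : ℝ) ^ 2 + (inner ℝ t Complex.I : ℝ) ^ 2) * -F (inner ℝ t z) :=
      fun z => laplacian_comp_clm hF hF' (innerSL ℝ t) z
    simp only [hlap] at h1
    have h2 : (inner ℝ t 1 : ℝ) ^ 2 + (inner ℝ t Complex.I : ℝ) ^ 2 ≠ 0 := by
      have h3 : (inner ℝ t 1 : ℝ) ^ 2 + (inner ℝ t Complex.I : ℝ) ^ 2 = ‖t‖ ^ 2 := by
        rw [← Complex.normSq_eq_norm_sq, Complex.normSq_apply]
        simp [Complex.inner]
        ring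
      rw [h3]
      exact pow_ne_zero 2 (norm_ne_zero_iff.2 ht)
    have h4 : ∀ z, f z * (((inner ℝ t 1 : ℝ) ^ 2 + (inner ℝ t Complex.I : ℝ) ^ 2) *
        -F (inner ℝ t z)) = -((inner ℝ t 1 : ℝ) ^ 2 + (inner ℝ t Complex.I : ℝ) ^ 2) *
        (f z * F (inner ℝ t z)) := fun z => by ring
    simp only [h4, integral_const_mul] at h1
    exact (mul_eq_zero.1 h1).resolve_left (neg_ne_zero.2 h2)
  have hcos : ∀ t : ℂ, ∫ z, f z * Real.cos (inner ℝ t z) = 0 := fun t => by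
    by_cases ht : t = 0
    · simpa [ht] using h0
    · exact hwave Real.cos (fun s => -Real.sin s) Real.contDiff_cos
        (fun s => Real.hasDerivAt_cos s) (fun s => (Real.hasDerivAt_sin s).neg) t ht
  have hsin : ∀ t : ℂ, ∫ z, f z * Real.sin (inner ℝ t z) = 0 := fun t => by
    by_cases ht : t = 0
    · simp [ht]
    · exact hwave Real.sin Real.cos Real.contDiff_sin
        (fun s => Real.hasDerivAt_sin s) (fun s => Real.hasDerivAt_cos s) t ht
  have hp : Measurable fun z => ENNReal.ofReal (f z) := hfm.ennreal_ofReal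
  have hn : Measurable fun z => ENNReal.ofReal (-f z) := hfm.neg.ennreal_ofReal
  have hpf : ∫⁻ z, ENNReal.ofReal (f z) ≠ ⊤ := hf.lintegral_lt_top.ne
  have hnf : ∫⁻ z, ENNReal.ofReal (-f z) ≠ ⊤ := hf.neg.lintegral_lt_top.ne
  have : IsFiniteMeasure (volume.withDensity fun z => ENNReal.ofReal (f z)) :=
    isFiniteMeasure_withDensity hpf
  have : IsFiniteMeasure (volume.withDensity fun z => ENNReal.ofReal (-f z)) :=
    isFiniteMeasure_withDensity hnf
  -- The Fourier transform of f vanishes, so the positive measures with densities f⁺ and f⁻ have the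
  -- same characteristic function and coincide.
  have hmeas : (volume.withDensity fun z => ENNReal.ofReal (f z)) =
      volume.withDensity fun z => ENNReal.ofReal (-f z) := by
    refine Measure.ext_of_charFun (funext fun t => ?_)
    have hce : Continuous fun z : ℂ => Complex.exp ((inner ℝ z t : ℝ) * Complex.I) := by fun_prop
    have hbd : ∀ z : ℂ, ‖Complex.exp ((inner ℝ z t : ℝ) * Complex.I)‖ ≤ 1 := fun z =>
      (Complex.norm_exp_ofReal_mul_I _).le
    rw [charFun_apply, charFun_apply,
      integral_withDensity_eq_integral_toReal_smul hp (ae_of_all _ fun _ => ENNReal.ofReal_lt_top),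
      integral_withDensity_eq_integral_toReal_smul hn (ae_of_all _ fun _ => ENNReal.ofReal_lt_top),
      ← sub_eq_zero, ← integral_sub]
    · have h1 : ∀ z : ℂ, (ENNReal.ofReal (f z)).toReal • Complex.exp ((inner ℝ z t : ℝ) * Complex.I) -
          (ENNReal.ofReal (-f z)).toReal • Complex.exp ((inner ℝ z t : ℝ) * Complex.I) =
          ((f z * Real.cos (inner ℝ t z) : ℝ) : ℂ) +
            ((f z * Real.sin (inner ℝ t z) : ℝ) : ℂ) * Complex.I := fun z => by
        rw [← sub_smul, ENNReal.toReal_ofReal', ENNReal.toReal_ofReal', max_zero_sub_max_neg_zero_eq_self,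
          Complex.exp_mul_I, real_inner_comm, Complex.real_smul]
        push_cast
        ring
      simp only [h1]
      have hi1 : Integrable fun z => ((f z * Real.cos (inner ℝ t z) : ℝ) : ℂ) :=
        (hf.mul_bdd (c := 1) (Continuous.aestronglyMeasurable (by fun_prop))
          (ae_of_all _ fun z => Real.abs_cos_le_one _)).ofReal
      have hi2 : Integrable fun z => ((f z * Real.sin (inner ℝ t z) : ℝ) : ℂ) * Complex.I :=
        ((hf.mul_bdd (c := 1) (Continuous.aestronglyMeasurable (by fun_prop))
          (ae_of_all _ fun z => Real.abs_sin_le_one _)).ofReal).mul_const _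
      rw [integral_add hi1 hi2, integral_mul_const, integral_complex_ofReal,
        integral_complex_ofReal, hcos, hsin]
      simp
    · exact (integrable_toReal_of_lintegral_ne_top hp.aemeasurable hpf).smul_bdd 1
        hce.aestronglyMeasurable (ae_of_all _ hbd)
    · exact (integrable_toReal_of_lintegral_ne_top hn.aemeasurable hnf).smul_bdd 1
        hce.aestronglyMeasurable (ae_of_all _ hbd)
  have hae := (withDensity_eq_iff hp.aemeasurable hn.aemeasurable hpf).1 hmeas
  filter_upwards [hae] with z hz
  have h1 := congrArg ENNReal.toReal hz
  rw [ENNReal.toReal_ofReal', ENNReal.toReal_ofReal'] at h1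
  have h2 := max_zero_sub_max_neg_zero_eq_self (f z)
  rw [h1, sub_self] at h2
  exact h2.symm

/-! ### Maxima and gluing -/

theorem circleMean_mono_of_sphere {u v : ℂ → EReal} {z : ℂ} {r : ℝ} (hr : 0 ≤ r)
    (h : ∀ w ∈ sphere z r, u w ≤ v w) : circleMean u z r ≤ circleMean v z r := by
  refine mul_le_mul_of_nonneg_left
    (erealIntegral_mono fun t => h _ (circleMap_mem_sphere z hr t)) ?_
  exact_mod_cast (by positivity : (0 : ℝ) ≤ (2 * Real.pi)⁻¹)

theorem IsSubharmonic.max {u v : ℂ → EReal} (hu : IsSubharmonic u) (hv : IsSubharmonic v) :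
    IsSubharmonic fun z => max (u z) (v z) where
  lt_top z := max_lt (hu.lt_top z) (hv.lt_top z)
  upperSemicontinuous := hu.upperSemicontinuous.sup hv.upperSemicontinuous
  submean z := by
    obtain ⟨ρ₁, h1, hu1⟩ := hu.submean z
    obtain ⟨ρ₂, h2, hv2⟩ := hv.submean z
    refine ⟨min ρ₁ ρ₂, lt_min h1 h2, fun r hr hrρ => max_le ?_ ?_⟩
    · exact (hu1 r hr (hrρ.trans_le (min_le_left _ _))).trans
        (circleMean_mono_of_sphere hr.le fun w _ => le_max_left _ _)
    · exact (hv2 r hr (hrρ.trans_le (min_le_right _ _))).trans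
        (circleMean_mono_of_sphere hr.le fun w _ => le_max_right _ _)

/-- Near a point where a function agrees with a subharmonic function, it satisfies the submean
inequality. -/
theorem IsSubharmonic.exists_submean_of_eventuallyEq {u v : ℂ → EReal} (hu : IsSubharmonic u)
    {z : ℂ} (h : v =ᶠ[𝓝 z] u) : ∃ ρ : ℝ, 0 < ρ ∧ ∀ r : ℝ, 0 < r → r < ρ → v z ≤ circleMean v z r := by
  obtain ⟨ρ₁, h1, hu1⟩ := hu.submean z
  obtain ⟨ρ₂, h2, h2'⟩ := Metric.eventually_nhds_iff.1 h
  refine ⟨min ρ₁ ρ₂, lt_min h1 h2, fun r hr hrρ => ?_⟩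
  rw [h.eq_of_nhds]
  refine (hu1 r hr (hrρ.trans_le (min_le_left _ _))).trans
    (circleMean_mono_of_sphere hr.le fun w hw => (h2' ?_).ge)
  rw [mem_sphere.1 hw]
  exact hrρ.trans_le (min_le_right _ _)

open Classical in
/-- Gluing of two comparable subharmonic functions that agree off an open set, along a union of
components of that set. -/
theorem IsSubharmonic.piecewise {u v : ℂ → EReal} (hu : IsSubharmonic u) (hv : IsSubharmonic v)
    {U V : Set ℂ} (hU : IsOpen U) (hVU : IsOpen (V \ U))
    (heq : ∀ z ∉ V, u z = v z) (hle : (∀ z, u z ≤ v z) ∨ ∀ z, v z ≤ u z) :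
    IsSubharmonic (U.piecewise u v) := by
  have hcase : ∀ z, U.piecewise u v =ᶠ[𝓝 z] u ∨ U.piecewise u v =ᶠ[𝓝 z] v ∨
      (z ∉ V ∧ z ∉ U) := by
    intro z
    by_cases hzU : z ∈ U
    · exact Or.inl ((hU.eventually_mem hzU).mono fun w hw => piecewise_eq_of_mem _ _ _ hw)
    by_cases hzV : z ∈ V
    · exact Or.inr (Or.inl ((hVU.eventually_mem ⟨hzV, hzU⟩).mono fun w hw =>
        piecewise_eq_of_notMem _ _ _ hw.2))
    · exact Or.inr (Or.inr ⟨hzV, hzU⟩)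
  refine ⟨fun z => ?_, fun z => ?_, fun z => ?_⟩
  · by_cases hz : z ∈ U
    · rw [piecewise_eq_of_mem _ _ _ hz]; exact hu.lt_top z
    · rw [piecewise_eq_of_notMem _ _ _ hz]; exact hv.lt_top z
  · rcases hcase z with h | h | ⟨hzV, hzU⟩
    · intro y hy
      have hy' : U.piecewise u v z < y := hy
      rw [h.eq_of_nhds] at hy'
      filter_upwards [h, hu.upperSemicontinuous z y hy'] with w hw hw'
      rw [hw]; exact hw'
    · intro y hy
      have hy' : U.piecewise u v z < y := hy
      rw [h.eq_of_nhds] at hy'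
      filter_upwards [h, hv.upperSemicontinuous z y hy'] with w hw hw'
      rw [hw]; exact hw'
    · intro y hy
      have hy' : U.piecewise u v z < y := hy
      rw [piecewise_eq_of_notMem _ _ _ hzU] at hy'
      filter_upwards [hv.upperSemicontinuous z y hy',
        hu.upperSemicontinuous z y ((heq z hzV).trans_lt hy')] with w hwv hwu
      by_cases hw : w ∈ U
      · rw [piecewise_eq_of_mem _ _ _ hw]; exact hwu
      · rw [piecewise_eq_of_notMem _ _ _ hw]; exact hwv
  · rcases hcase z with h | h | ⟨hzV, hzU⟩
    · exact hu.exists_submean_of_eventuallyEq h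
    · exact hv.exists_submean_of_eventuallyEq h
    · rw [piecewise_eq_of_notMem _ _ _ hzU]
      -- Off V the two values agree, so the submean inequality of the smaller function suffices: the
      -- glued function dominates it everywhere.
      rcases hle with hle | hle
      · obtain ⟨ρ, hρ, h⟩ := hu.submean z
        refine ⟨ρ, hρ, fun r hr hrρ => ?_⟩
        rw [← heq z hzV]
        refine (h r hr hrρ).trans (circleMean_mono_of_sphere hr.le fun w _ => ?_)
        by_cases hw : w ∈ U
        · rw [piecewise_eq_of_mem _ _ _ hw]
        · rw [piecewise_eq_of_notMem _ _ _ hw]; exact hle w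
      · obtain ⟨ρ, hρ, h⟩ := hv.submean z
        refine ⟨ρ, hρ, fun r hr hrρ =>
          (h r hr hrρ).trans (circleMean_mono_of_sphere hr.le fun w _ => ?_)⟩
        by_cases hw : w ∈ U
        · rw [piecewise_eq_of_mem _ _ _ hw]; exact hle w
        · rw [piecewise_eq_of_notMem _ _ _ hw]

/-! ### Uniqueness when the closure is not charged -/

theorem IsSubharmonic.exists_ne_bot_of_eqOn_compl {u v : ℂ → EReal} (hv : IsSubharmonic v)
    (hne : ∃ z, v z ≠ ⊥) {K : Set ℂ} (hK : IsCompact K) (h : ∀ z ∉ K, u z = v z) :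
    ∃ z, u z ≠ ⊥ := by
  by_contra hcon
  push Not at hcon
  have h1 : ∀ᵐ z : ℂ, z ∈ K := by
    filter_upwards [hv.ae_ne_bot hne] with z hz
    by_contra hzK
    exact hz ((h z hzK).symm.trans (hcon z))
  have h2 : volume Kᶜ = 0 := h1
  have h3 : K = univ := compl_empty_iff.1 ((hK.isClosed.isOpen_compl.measure_eq_zero_iff volume).1 h2)
  exact noncompact_univ ℂ (h3 ▸ hK)

/-- If two subharmonic functions agree off a bounded set whose closure is not charged by the
Laplacian of the second, then they are equal. -/
theorem IsSubharmonic.eq_of_measure_closure_eq_zero {u v : ℂ → EReal} (hu : IsSubharmonic u)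
    (hv : IsSubharmonic v) (hne : ∃ z, v z ≠ ⊥) {μ : Measure ℂ} (hμ : IsLaplacian v μ) {U : Set ℂ}
    (hU : IsCompact (closure U)) (heq : ∀ z ∉ U, u z = v z) (h0 : μ (closure U) = 0) (z : ℂ) :
    u z = v z := by
  have : IsFiniteMeasureOnCompacts μ := ⟨hμ.finite_of_isCompact⟩
  have hneu : ∃ z, u z ≠ ⊥ := hv.exists_ne_bot_of_eqOn_compl hne hU
    fun z hz => heq z fun h => hz (subset_closure h)
  set f : ℂ → ℝ := fun z => (u z).toReal - (v z).toReal with hf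
  have hf0 : ∀ z ∉ U, f z = 0 := fun z hz => by simp [hf, heq z hz]
  have hfm : Measurable f := hu.measurable.ereal_toReal.sub hv.measurable.ereal_toReal
  have hfi : Integrable f := by
    have h1 : IntegrableOn f (closure U) := ((hu.locallyIntegrable hneu).integrableOn_isCompact hU).sub
      ((hv.locallyIntegrable hne).integrableOn_isCompact hU)
    exact h1.integrable_of_forall_notMem_eq_zero fun z hz => hf0 z fun h => hz (subset_closure h)
  have hμi : ∀ ψ : ℂ → ℝ, ContDiff ℝ (⊤ : ℕ∞) ψ → HasCompactSupport ψ → Integrable ψ μ :=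
    fun ψ hψ hc => hψ.continuous.integrable_of_hasCompactSupport hc
  have hui : ∀ ψ : ℂ → ℝ, ContDiff ℝ (⊤ : ℕ∞) ψ → HasCompactSupport ψ →
      Integrable fun z => (u z).toReal * Laplacian.laplacian ψ z :=
    fun ψ hψ hc => hu.integrable_mul hneu hψ.continuous_laplacian hc.laplacian
  have hD : ∀ ψ : ℂ → ℝ, ContDiff ℝ (⊤ : ℕ∞) ψ → HasCompactSupport ψ →
      ∫ z, f z * Laplacian.laplacian ψ z =
        (∫ z, (u z).toReal * Laplacian.laplacian ψ z) - ∫ z, ψ z ∂μ := by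
    intro ψ hψ hc
    rw [hμ.integral_eq ψ hψ hc, ← integral_sub (hui ψ hψ hc)
      (hv.integrable_mul hne hψ.continuous_laplacian hc.laplacian)]
    simp only [hf, sub_mul]
  have hDconst : ∀ (ψ : ℂ → ℝ) (a : ℝ), (∀ z ∈ closure U, ψ =ᶠ[𝓝 z] fun _ => a) →
      ∫ z, f z * Laplacian.laplacian ψ z = 0 := by
    intro ψ a h
    refine integral_eq_zero_of_ae (ae_of_all _ fun z => ?_)
    by_cases hz : z ∈ U
    · have : Laplacian.laplacian ψ z = 0 := by
        rw [(InnerProductSpace.laplacian_congr_nhds (h z (subset_closure hz))).eq_of_nhds]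
        exact congrFun InnerProductSpace.laplacian_const z
      simp [this]
    · simp [hf0 z hz]
  have hzero : ∀ φ : ℂ → ℝ, ContDiff ℝ (⊤ : ℕ∞) φ → HasCompactSupport φ →
      ∫ z, f z * Laplacian.laplacian φ z = 0 := by
    intro φ hφ hc
    obtain ⟨M, hM⟩ := hc.exists_bound_of_continuous hφ.continuous
    have hM0 : 0 ≤ M := (norm_nonneg _).trans (hM 0)
    -- Localise to a neighbourhood V of the closure with μ(V) < ε. Near the closure the Laplacian of
    -- u will have no more mass than μ.
    have key : ∀ ε : ℝ, 0 < ε → |∫ z, f z * Laplacian.laplacian φ z| ≤ 2 * M * ε := by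
      intro ε hε
      obtain ⟨V, hUV, hV, hVε⟩ := (closure U).exists_isOpen_lt_of_lt (μ := μ) (ENNReal.ofReal ε)
        (by rw [h0]; exact ENNReal.ofReal_pos.2 hε)
      obtain ⟨χ, hχ, hχc, hχ1, hχV, hχ0⟩ := exists_contDiff_cutoff hU hV hUV
      have hφχ : ContDiff ℝ (⊤ : ℕ∞) fun z => φ z * χ z := hφ.mul hχ
      have hφχc : HasCompactSupport fun z => φ z * χ z := hc.mul_right
      have hχμ : ∫ z, χ z ∂μ ≤ ε := by
        have h1 : ∫ z, χ z ∂μ ≤ ∫ z, V.indicator 1 z ∂μ := by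
          refine integral_mono (hμi χ hχ hχc) ?_ fun z => ?_
          · exact (integrable_indicator_iff hV.measurableSet).2
              (integrableOn_const (hVε.trans_le le_top).ne)
          · by_cases hz : z ∈ V
            · rw [indicator_of_mem hz]; exact (hχ0 z).2
            · rw [indicator_of_notMem hz, hχV z hz]
        rw [integral_indicator_one hV.measurableSet] at h1
        refine h1.trans ?_
        rw [measureReal_def]
        exact ENNReal.toReal_le_of_le_ofReal hε.le hVε.le
      -- χ is constant near the closure of U and u = v off U, so testing χ cannot distinguish the
      -- two Laplacians: their masses near the closure agree.
      have hχ2 : ∫ z, (u z).toReal * Laplacian.laplacian χ z = ∫ z, χ z ∂μ := by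
        have h1 := hDconst χ 1 hχ1
        rw [hD χ hχ hχc] at h1
        linarith
      have hsplit : ∫ z, f z * Laplacian.laplacian φ z =
          ∫ z, f z * Laplacian.laplacian (fun z => φ z * χ z) z := by
        have hψ : ContDiff ℝ (⊤ : ℕ∞) fun z => φ z * (1 - χ z) :=
          hφ.mul (contDiff_const.sub hχ)
        have hψc : HasCompactSupport fun z => φ z * (1 - χ z) := hc.mul_right
        have h1 := hDconst (fun z => φ z * (1 - χ z)) 0 fun z hz =>
          (hχ1 z hz).mono fun w hw => by simp [hw]
        have h2 : φ = (fun z => φ z * χ z) + fun z => φ z * (1 - χ z) := by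
          ext z; simp only [Pi.add_apply]; ring
        have h3 : ∀ z, (u z).toReal * Laplacian.laplacian φ z =
            (u z).toReal * Laplacian.laplacian (fun z => φ z * χ z) z +
            (u z).toReal * Laplacian.laplacian (fun z => φ z * (1 - χ z)) z := fun z => by
          conv_lhs => rw [h2]
          rw [laplacian_add_of_contDiff hφχ hψ, mul_add]
        have h4 : ∫ z, φ z ∂μ = (∫ z, φ z * χ z ∂μ) + ∫ z, φ z * (1 - χ z) ∂μ := by
          rw [← integral_add (hμi _ hφχ hφχc) (hμi _ hψ hψc)]
          refine integral_congr_ae (ae_of_all _ fun z => ?_)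
          ring
        rw [hD _ hψ hψc] at h1
        rw [hD φ hφ hc, hD _ hφχ hφχc, h4]
        simp only [h3]
        rw [integral_add (hui _ hφχ hφχc) (hui _ hψ hψc)]
        linarith
      -- Positivity of the Laplacian of u, tested on (M + σφ)χ ≥ 0 where |φ| ≤ M. Taking σ = ±1
      -- bounds its action on φχ by M times the small mass just computed.
      have hpos : ∀ σ : ℝ, |σ| ≤ 1 → 0 ≤ M * (∫ z, χ z ∂μ) +
          σ * ∫ z, (u z).toReal * Laplacian.laplacian (fun z => φ z * χ z) z := by
        intro σ hσ
        have hs1 : ContDiff ℝ (⊤ : ℕ∞) (M • χ) := hχ.const_smul M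
        have hs2 : ContDiff ℝ (⊤ : ℕ∞) (σ • fun z => φ z * χ z) := hφχ.const_smul σ
        have h1 := hu.integral_mul_laplacian_nonneg hneu (φ := M • χ + σ • fun z => φ z * χ z)
          (hs1.add hs2) ((hχc.smul_left (f := fun _ => M)).add
            (hφχc.smul_left (f := fun _ => σ))) (fun z => by
            simp only [Pi.add_apply, Pi.smul_apply, smul_eq_mul]
            have h2 : |σ * φ z| ≤ M := by
              rw [abs_mul]
              have := hM z
              rw [Real.norm_eq_abs] at this
              nlinarith [abs_nonneg (φ z), abs_nonneg σ]
            nlinarith [(hχ0 z).1, neg_abs_le (σ * φ z)])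
        have h3 : ∀ z, (u z).toReal * Laplacian.laplacian (M • χ + σ • fun z => φ z * χ z) z =
            M * ((u z).toReal * Laplacian.laplacian χ z) +
            σ * ((u z).toReal * Laplacian.laplacian (fun z => φ z * χ z) z) := fun z => by
          rw [laplacian_add_of_contDiff hs1 hs2, laplacian_smul_of_contDiff hχ,
            laplacian_smul_of_contDiff hφχ]
          ring
        simp only [h3] at h1
        rw [integral_add ((hui _ hχ hχc).const_mul M) ((hui _ hφχ hφχc).const_mul σ),
          integral_const_mul, integral_const_mul, hχ2] at h1
        exact h1
      have hp := hpos 1 (by simp)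
      have hn := hpos (-1) (by simp)
      have hφμ : |∫ z, φ z * χ z ∂μ| ≤ M * ∫ z, χ z ∂μ := by
        rw [← integral_const_mul, ← Real.norm_eq_abs]
        refine norm_integral_le_of_norm_le ((hμi χ hχ hχc).const_mul M) (ae_of_all _ fun z => ?_)
        rw [norm_mul, Real.norm_of_nonneg (hχ0 z).1]
        exact mul_le_mul_of_nonneg_right (hM z) (hχ0 z).1
      rw [hsplit, hD _ hφχ hφχc]
      have hMε : M * ∫ z, χ z ∂μ ≤ M * ε := mul_le_mul_of_nonneg_left hχμ hM0
      rw [abs_le] at hφμ ⊢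
      constructor <;> linarith [hφμ.1, hφμ.2]
    have hlim : Tendsto (fun ε : ℝ => 2 * M * ε) (𝓝[>] 0) (𝓝 0) := by
      have : Continuous fun ε : ℝ => 2 * M * ε := by fun_prop
      have h2 := (this.tendsto 0).mono_left (nhdsWithin_le_nhds (s := Ioi 0))
      simpa using h2
    exact abs_nonpos_iff.1
      (ge_of_tendsto hlim (eventually_mem_nhdsWithin.mono fun ε hε => key ε hε))
  have hae := ae_eq_zero_of_forall_integral_mul_laplacian hU hfm hfi
    (fun z hz => hf0 z fun h => hz (subset_closure h)) hzero
  have huv : ∀ᵐ z, u z = v z := by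
    filter_upwards [hae, hu.ae_ne_bot hneu, hv.ae_ne_bot hne] with z hz hzu hzv
    rw [← EReal.coe_toReal (hu.lt_top z).ne hzu, ← EReal.coe_toReal (hv.lt_top z).ne hzv,
      sub_eq_zero.1 hz]
  exact le_antisymm (hu.le_of_ae_le hv (huv.mono fun z hz => hz.le) z)
    (hv.le_of_ae_le hu (huv.mono fun z hz => hz.ge) z)

/-! ### Boundary values and conclusion -/

/-- The connected complement contains points closer to z than r, since z is a boundary point, and
points farther away, since K is bounded; the intermediate value theorem for the distance to z does
the rest. -/
theorem IsCompact.exists_mem_compl_sphere {K : Set ℂ} (hK : IsCompact K) (hKc : IsConnected Kᶜ)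
    {z : ℂ} (hz : z ∈ frontier K) {r : ℝ} (hr : 0 < r) : ∃ w ∈ sphere z r, w ∉ K := by
  have hzc : z ∈ closure Kᶜ := by
    rw [← frontier_compl] at hz
    exact frontier_subset_closure hz
  obtain ⟨a, ha, hza⟩ := Metric.mem_closure_iff.1 hzc r hr
  obtain ⟨b, hb⟩ : ∃ b, b ∉ closedBall z r ∪ K := by
    by_contra hcon
    push Not at hcon
    exact noncompact_univ ℂ ((eq_univ_of_forall hcon) ▸ (isCompact_closedBall z r).union hK)
  rw [mem_union, not_or, mem_closedBall, not_le] at hb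
  have hcont : ContinuousOn (fun w => dist w z) Kᶜ := by fun_prop
  obtain ⟨w, hw, hwr⟩ := hKc.isPreconnected.intermediate_value ha hb.2 hcont
    ⟨(by rw [dist_comm]; exact hza.le : dist a z ≤ r), hb.1.le⟩
  exact ⟨w, hwr, hw⟩

theorem IsSubharmonic.le_of_mem_frontier {u v : ℂ → EReal} (hu : IsSubharmonic u)
    (hv : IsSubharmonic v) {K : Set ℂ} (hK : IsCompact K) (hKc : IsConnected Kᶜ)
    (huv : ∀ z ∉ K, u z = v z) {z : ℂ} (hz : z ∈ frontier K) : u z ≤ v z := by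
  by_contra hcon
  rw [not_le] at hcon
  obtain ⟨c, hc1, hc2⟩ := EReal.lt_iff_exists_real_btwn.1 hcon
  obtain ⟨ρ, hρ, hρ'⟩ := Metric.eventually_nhds_iff.1 (hv.upperSemicontinuous z c hc1)
  refine absurd hc2 (not_lt.2 (hu.le_of_forall_sphere hρ fun r hr hrρ => ?_))
  obtain ⟨w, hw, hwK⟩ := hK.exists_mem_compl_sphere hKc hz hr
  refine ⟨w, hw, (huv w hwK).le.trans (hρ' ?_).le⟩
  rw [mem_sphere.1 hw]; exact hrρ

/-- The remainder is the union of the other components, each open because the plane is locally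
connected. -/
theorem isOpen_diff_connectedComponentIn {V : Set ℂ} (hV : IsOpen V) (z : ℂ) :
    IsOpen (V \ connectedComponentIn V z) := by
  rw [isOpen_iff_mem_nhds]
  rintro w ⟨hwV, hwz⟩
  filter_upwards [hV.connectedComponentIn.mem_nhds (mem_connectedComponentIn hwV)] with y hy
  refine ⟨connectedComponentIn_subset V w hy, fun hyz => hwz ?_⟩
  rw [connectedComponentIn_eq hyz, ← connectedComponentIn_eq hy]
  exact mem_connectedComponentIn hwV

/-- Two comparable subharmonic functions that agree off the interior of `K` are equal, if the
Laplacian of the second charges neither the interior of `K` nor the boundary of its components. -/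
theorem IsSubharmonic.eq_of_comparable {K : Set ℂ} (hK : IsCompact K) {u v : ℂ → EReal}
    (hu : IsSubharmonic u) (hv : IsSubharmonic v) (hne : ∃ z, v z ≠ ⊥) {μ : Measure ℂ}
    (hμ : IsLaplacian v μ) (hsupp : μ.support ⊆ frontier K)
    (hcharge : ∀ z ∈ interior K, μ (frontier (connectedComponentIn (interior K) z)) = 0)
    (huv : ∀ z ∉ interior K, u z = v z) (hle : (∀ z, u z ≤ v z) ∨ ∀ z, v z ≤ u z) (z : ℂ) :
    u z = v z := by
  classical
  by_cases hz : z ∉ interior K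
  · exact huv z hz
  rw [not_not] at hz
  set U := connectedComponentIn (interior K) z with hU
  have hUo : IsOpen U := isOpen_interior.connectedComponentIn
  have hUK : U ⊆ interior K := connectedComponentIn_subset _ _
  have hcl : IsCompact (closure U) :=
    hK.of_isClosed_subset isClosed_closure
      (closure_minimal (hUK.trans interior_subset) hK.isClosed)
  have hμU : μ U = 0 := by
    have h : U ⊆ μ.supportᶜ := fun w hw hws => (hsupp hws).2 (hUK hw)
    exact measure_mono_null h Measure.measure_compl_support
  have hμcl : μ (closure U) = 0 := by
    rw [closure_eq_self_union_frontier]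
    exact measure_union_null hμU (hcharge z hz)
  -- One component at a time: the charge condition concerns each component boundary separately, so u
  -- is replaced by v on all other components.
  have hpw := hu.piecewise hv hUo (isOpen_diff_connectedComponentIn isOpen_interior z) huv hle
  have := hpw.eq_of_measure_closure_eq_zero hv hne hμ hcl
    (fun w hw => piecewise_eq_of_notMem _ _ _ hw) hμcl z
  rwa [piecewise_eq_of_mem _ _ _ (mem_connectedComponentIn hz)] at this

theorem mainTheorem2 (K : Set ℂ) (hK : IsCompact K) (hKc : IsConnected Kᶜ)
    (v : ℂ → EReal) (hv : IsSubharmonic v) (hv_ne : ∃ z, v z ≠ ⊥)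
    (hsupp : (laplacianMeasure v).support ⊆ frontier K)
    (hcharge : ∀ z ∈ interior K,
      laplacianMeasure v (frontier (connectedComponentIn (interior K) z)) = 0)
    (u : ℂ → EReal) (hu : IsSubharmonic u) (huv : ∀ z, z ∉ K → u z = v z) :
    ∀ z, u z = v z := by
  have hμ := hv.isLaplacian_laplacianMeasure hv_ne
  have hint : ∀ z ∉ interior K, u z = v z := by
    intro z hz
    by_cases hzK : z ∈ K
    · have hzf : z ∈ frontier K := ⟨subset_closure hzK, hz⟩
      exact le_antisymm (hu.le_of_mem_frontier hv hK hKc huv hzf)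
        (hv.le_of_mem_frontier hu hK hKc (fun w hw => (huv w hw).symm) hzf)
    · exact huv z hzK
  -- Gluing needs comparable functions. The maximum lies above v, so it equals v; this says u ≤ v,
  -- and then u itself is comparable with v.
  have hmax := (hu.max hv).eq_of_comparable hK hv hv_ne hμ hsupp hcharge
    (fun z hz => by rw [hint z hz, max_self]) (Or.inr fun z => le_max_right _ _)
  exact hu.eq_of_comparable hK hv hv_ne hμ hsupp hcharge hint
    (Or.inl fun z => max_eq_right_iff.1 (hmax z))
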